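/- Consider evolutionary systems, with constant complex coefficients, for a scalar function $u(x,t)$ and a vector function $U=(U_1,\dots,U_N)$, where $\langle V,W\rangle=\sum_{j=1}^N V_jW_j$. The number $N\ge 1$ of components is arbitrary, and coefficients do not depend on $N$. A right-hand side for $u$ is a polynomial in the $\partial_x^k u$ and the $\langle\partial_x^mU,\partial_x^nU\rangle$; a right-hand side for $U$ is a linear combination of the $\partial_x^kU$ whose coefficients are such polynomials. Let $$ \begin{aligned} u_t&=a_1u_{xx}+a_2uu_x+a_3u^3+a_4u\langle U,U\rangle+a_5\langle U,U_x\rangle,\\ U_t&=a_6U_{xx}+a_7u_xU+a_8uU_x+a_9u^2U+a_{10}\langle U,U\rangle U, \end{aligned} \qquad (\ast) $$ where $a_1,\dots,a_{10}\in\mathbb C$, $(a_1,a_6)\ne(0,0)$, $(a_4,a_5)\ne(0,0)$ and $(a_7,a_8,a_9)\ne(0,0,0)$. A 4th-order symmetry of $(\ast)$ is a system $u_\tau=H$, $U_\tau=K$ of the above kind such that: it is homogeneous for the weights in which $u$, $U$ and $\partial_x$ all have weight $1$, every term of $H$ and of $K$ having weight $5$; at least one of the terms $u_{xxxx}$ (in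 $H$) and $U_{xxxx}$ (in $K$) occurs with nonzero coefficient; $H\ne0$ and $K\ne0$; and the flows commute, that is, $\partial_t H=\partial_\tau(u_t)$ and $\partial_t K=\partial_\tau(U_t)$ hold identically for every $N\ge1$. If $(\ast)$ has a 4th-order symmetry, then a scaling $t\mapsto\tau t$, $x\mapsto\xi x$, $u\mapsto\mu u$, $U\mapsto\nu U$ with nonzero constants $\tau,\xi,\mu,\nu\in\mathbb C$ turns it into one of the following three systems: 1. for some $a\in\mathbb C$, $$ \begin{aligned} u_t&=\tfrac13(1+2a)(u_{xx}+2uu_x)+\tfrac43\langle U,U_x\rangle,\\ U_t&=U_{xx}+\tfrac13(1-a)u_xU+uU_x+\tfrac1{12}(1-4a)u^2U-\tfrac13\langle U,U\rangle U; \end{aligned} $$ 2. $$ u_t=u_{xx}+2uu_x+2\langle U,U_x\rangle,\qquad U_t=-\tfrac12u_xU-\tfrac12u^2U-\tfrac12\langle U,U\rangle U; $$ 3. $$ u_t=u_{xx}+2uu_x+\langle U,U_x\rangle,\qquad U_t=\tfrac12u_xU+uU_x. $$ -/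

import Mathlib

noncomputable section

namespace CoupledEvolution

open MvPolynomial

/-- The scalar quantities from which a right-hand side may be built: `u k` is `∂ₓᵏ u`, and
`s m d` is the scalar product `⟨∂ₓᵐ U, ∂ₓᵐ⁺ᵈ U⟩`. Every scalar product `⟨∂ₓᵐ U, ∂ₓⁿ U⟩` is
`s (min m n) (max m n - min m n)`, so each occurs exactly once. -/
inductive ScalarGen : Type
  | u (k : ℕ) : ScalarGen
  | s (m d : ℕ) : ScalarGen

/-- Polynomials with constant coefficients in the `∂ₓᵏ u` and the `⟨∂ₓᵐ U, ∂ₓⁿ U⟩`.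
The number `N` of components of `U` does not enter. -/
abbrev ScalarPoly : Type := MvPolynomial ScalarGen ℂ

/-- An evolutionary system for a scalar `u` and a vector `U`:
`u_t = scalar`, `U_t = ∑ₖ (vector k) ∂ₓᵏ U`. -/
structure EvolutionSystem : Type where
  scalar : ScalarPoly
  vector : ℕ →₀ ScalarPoly

/-! ### Weights, for `λ₁ = λ₂ = 1` -/

/-- `u` and `U` have weight `1`, and each `∂ₓ` adds `1`. -/
def ScalarGen.weight : ScalarGen → ℕ
  | .u k => k + 1
  | .s m d => (m + 1) + (m + d + 1)

/-- `λ₁ = λ₂ = 1` homogeneity of weight `μ`: as `∂_t` has weight `μ`, every term of `u_t` and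
every term `M ∂ₓᵏ U` of `U_t` has weight `μ + 1`. -/
def EvolutionSystem.IsHomogeneous (S : EvolutionSystem) (μ : ℕ) : Prop :=
  (∀ d : ScalarGen →₀ ℕ, coeff d S.scalar ≠ 0 →
    Finsupp.weight ScalarGen.weight d = μ + 1) ∧
  (∀ (k : ℕ) (d : ScalarGen →₀ ℕ), coeff d (S.vector k) ≠ 0 →
    Finsupp.weight ScalarGen.weight d + (k + 1) = μ + 1)

/-! ### Realization with an `N`-component vector `U = (U₁, …, U_N)` -/

/-- Jet variables: `u k` is `∂ₓᵏ u`, and `U j k` is `∂ₓᵏ U_j`. -/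
inductive JetVar (N : ℕ) : Type
  | u (k : ℕ) : JetVar N
  | U (j : Fin N) (k : ℕ) : JetVar N

/-- Differential polynomials in `u, U₁, …, U_N`. -/
abbrev DiffPoly (N : ℕ) : Type := MvPolynomial (JetVar N) ℂ

/-- The total `x`-derivative. -/
def totalDeriv (N : ℕ) : Derivation ℂ (DiffPoly N) (DiffPoly N) :=
  mkDerivation ℂ fun
    | .u k => X (.u (k + 1))
    | .U j k => X (.U j (k + 1))

/-- The value of a scalar quantity, with `⟨V, W⟩ = ∑ⱼ Vⱼ Wⱼ`. -/
def ScalarGen.toDiffPoly (N : ℕ) : ScalarGen → DiffPoly N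
  | .u k => X (.u k)
  | .s m d => ∑ j : Fin N, X (.U j m) * X (.U j (m + d))

/-- The value of a scalar expression. -/
def ScalarPoly.toDiffPoly (N : ℕ) : ScalarPoly →ₐ[ℂ] DiffPoly N :=
  aeval (ScalarGen.toDiffPoly N)

/-- The right-hand side of the equation for `u`. -/
def EvolutionSystem.scalarRHS (S : EvolutionSystem) (N : ℕ) : DiffPoly N :=
  ScalarPoly.toDiffPoly N S.scalar

/-- The right-hand side of the equation for the component `U_j`. -/
def EvolutionSystem.vectorRHS (S : EvolutionSystem) (N : ℕ) (j : Fin N) : DiffPoly N :=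
  S.vector.sum fun k p => ScalarPoly.toDiffPoly N p * X (.U j k)

/-- The time derivative `∂_t` along the system: the derivation with
`∂_t (∂ₓᵏ u) = ∂ₓᵏ (u_t)` and `∂_t (∂ₓᵏ U_j) = ∂ₓᵏ ((U_j)_t)`. -/
def EvolutionSystem.timeDeriv (S : EvolutionSystem) (N : ℕ) :
    Derivation ℂ (DiffPoly N) (DiffPoly N) :=
  mkDerivation ℂ fun
    | .u k => (totalDeriv N)^[k] (S.scalarRHS N)
    | .U j k => (totalDeriv N)^[k] (S.vectorRHS N j)

/-- The flows `∂_t` of `S` and `∂_τ` of `T` commute, `u_{tτ} = u_{τt}` and `U_{tτ} = U_{τt}`,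
whatever the number `N` of components of `U`. -/
def EvolutionSystem.FlowsCommute (S T : EvolutionSystem) : Prop :=
  ∀ N : ℕ, 1 ≤ N →
    S.timeDeriv N (T.scalarRHS N) = T.timeDeriv N (S.scalarRHS N) ∧
    ∀ j : Fin N, S.timeDeriv N (T.vectorRHS N j) = T.timeDeriv N (S.vectorRHS N j)

/-- `T` is a symmetry of order `n` of `S`: it is `λ₁ = λ₂ = 1` homogeneous of weight `n`, it
involves an `n`-th order derivative (by homogeneity this can only be a linear term `∂ₓⁿ u` in
the first or `∂ₓⁿ U` in the second equation), both of its right-hand sides are nonzero, and its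
flow commutes with that of `S`. -/
def EvolutionSystem.IsSymmetryOfOrder (n : ℕ) (S T : EvolutionSystem) : Prop :=
  T.IsHomogeneous n ∧
  (coeff (Finsupp.single (ScalarGen.u n) 1) T.scalar ≠ 0 ∨ T.vector n ≠ 0) ∧
  T.scalar ≠ 0 ∧ T.vector ≠ 0 ∧
  S.FlowsCommute T

/-! ### Scalings of `t, x, u, U` -/

/-- The substitution `∂ₓᵏ u ↦ μ ξᵏ ∂ₓᵏ u`, `∂ₓᵏ U ↦ ν ξᵏ ∂ₓᵏ U` in scalar expressions. -/
def rescale (ξ μ ν : ℂ) : ScalarPoly →ₐ[ℂ] ScalarPoly :=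
  aeval fun
    | .u k => C (μ * ξ ^ k) * X (.u k)
    | .s m d => C ((ν * ξ ^ m) * (ν * ξ ^ (m + d))) * X (.s m d)

/-- `S` turns into `S'` under a change of variables `t' = τ t`, `x' = ξ x`, `u = μ u'`,
`U = ν U'` with nonzero constants `τ, ξ, μ, ν`: in the new variables the equations of `S` read
`μ τ u'_{t'} = …` and `ν τ U'_{t'} = …`. -/
def EvolutionSystem.CoincideUpToScaling (S S' : EvolutionSystem) : Prop :=
  ∃ τ ξ μ ν : ℂ, τ ≠ 0 ∧ ξ ≠ 0 ∧ μ ≠ 0 ∧ ν ≠ 0 ∧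
    C (μ * τ) * S'.scalar = rescale ξ μ ν S.scalar ∧
    ∀ k : ℕ, C (ν * τ) * S'.vector k = C (ν * ξ ^ k) * rescale ξ μ ν (S.vector k)

/-! ### The second order systems -/

/-- The system
`u_t = a₁ u_xx + a₂ u u_x + a₃ u³ + a₄ u ⟨U,U⟩ + a₅ ⟨U,U_x⟩`,
`U_t = a₆ U_xx + a₇ u_x U + a₈ u U_x + a₉ u² U + a₁₀ ⟨U,U⟩ U`. -/
def secondOrderSystem (a₁ a₂ a₃ a₄ a₅ a₆ a₇ a₈ a₉ a₁₀ : ℂ) : EvolutionSystem where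
  scalar :=
    C a₁ * X (.u 2) + C a₂ * (X (.u 0) * X (.u 1)) + C a₃ * X (.u 0) ^ 3
      + C a₄ * (X (.u 0) * X (.s 0 0)) + C a₅ * X (.s 0 1)
  vector :=
    Finsupp.single 2 (C a₆)
      + Finsupp.single 1 (C a₈ * X (.u 0))
      + Finsupp.single 0 (C a₇ * X (.u 1) + C a₉ * X (.u 0) ^ 2 + C a₁₀ * X (.s 0 0))

/-- `u_t = (1+2a)/3 (u_xx + 2 u u_x) + 4/3 ⟨U,U_x⟩`,
`U_t = U_xx + (1-a)/3 u_x U + u U_x + (1-4a)/12 u² U - 1/3 ⟨U,U⟩ U`. -/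
def systemA (a : ℂ) : EvolutionSystem :=
  secondOrderSystem ((1 + 2 * a) / 3) ((1 + 2 * a) / 3 * 2) 0 0 (4 / 3)
    1 ((1 - a) / 3) 1 ((1 - 4 * a) / 12) (-1 / 3)

/-- `u_t = u_xx + 2 u u_x + 2 ⟨U,U_x⟩`, `U_t = -1/2 u_x U - 1/2 u² U - 1/2 ⟨U,U⟩ U`. -/
def systemB : EvolutionSystem :=
  secondOrderSystem 1 2 0 0 2 0 (-1 / 2) 0 (-1 / 2) (-1 / 2)

/-- `u_t = u_xx + 2 u u_x + ⟨U,U_x⟩`, `U_t = 1/2 u_x U + u U_x`. -/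
def systemC : EvolutionSystem :=
  secondOrderSystem 1 2 0 0 1 0 (1 / 2) 1 0 0

end CoupledEvolution

end

/-! Write `h₁, …, h₁₈` and `k₁, …, k₂₁` for the coefficients of the general pair `(H, K)` of weight
5; `h₁₅` and `k₁` belong to `u_xxxx` and `U_xxxx`. Commutation of the flows is a system of equations
bilinear in the `aᵢ` and the `hᵢ, kᵢ`, one for each jet monomial of the commutator. It suffices to
take `N = 2` (a single component would identify `⟨U,U_x⟩U` with `⟨U,U⟩U_x`) and some sixty of these
equations. They are listed in `scalarTable` and `vectorTable`, verified by exact list arithmetic,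
and transferred to true differential polynomials in `determined_of_flowsCommute`.

By bilinearity the system and the symmetry may be normalized independently. The case distinction is
governed by symbols: if `A = a₅(ξ+η)/2` and `B` are the symbols of the parts of `u_t` and `u_τ`
quadratic in `U`, then `B · (a₁(ξ+η)² - a₆(ξ²+η²)) = A · (h₁₅(ξ+η)⁴ - k₁(ξ⁴+η⁴))`. If `a₆ = 0`,
divisibility by `(ξ+η)²`, with its analogue in the equation for `U`, forces `k₁ = 0`
(`fourth_vanishes`); the remaining equations leave systems B and C (`scalar_order_two`). If `a₆ ≠ 0`
and `k₁ = 0`, divisibility fails unless `a₄ = a₅ = 0`, which is excluded (`decoupled`). If `a₆` and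
`k₁` are both nonzero, everything is determined by `a₁/a₆` up to scaling, which gives the family A
(`vector_order_two`). -/

noncomputable section

namespace CoupledEvolution

open MvPolynomial

namespace Reflection

/-! ### Computable differential polynomials for `N = 2` -/

/-- The jet variables of `N = 2` components, numbered so that `∂ₓ` adds `3`. -/
def jet (v : ℕ) : JetVar 2 :=
  if v % 3 = 0 then .u (v / 3) else if v % 3 = 1 then .U 0 (v / 3) else .U 1 (v / 3)

/-- A term: an integer, a list of parameters and a list of jet variables. -/
abbrev Term : Type := ℤ × List ℕ × List ℕ

/-- A differential polynomial, as a list of terms. -/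
abbrev Pol : Type := List Term

/-- Inserts a number into a sorted list. -/
def insertNat (a : ℕ) : List ℕ → List ℕ
  | [] => [a]
  | b :: l => bif a.ble b then a :: b :: l else b :: insertNat a l

/-- Sorted concatenation. -/
def merge (l₁ l₂ : List ℕ) : List ℕ := l₁.foldr insertNat l₂

def eqList : List ℕ → List ℕ → Bool
  | [], [] => true
  | a :: l, b :: m => bif a.beq b then eqList l m else false
  | _, _ => false

def mulTerm (s t : Term) : Term := (s.1 * t.1, merge s.2.1 t.2.1, merge s.2.2 t.2.2)

def mul (p q : Pol) : Pol := p.flatMap fun s => q.map (mulTerm s)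

/-- Adds a term to a polynomial. -/
def insertTerm (t : Term) : Pol → Pol
  | [] => [t]
  | s :: p => bif eqList t.2.2 s.2.2 && eqList t.2.1 s.2.1 then (t.1 + s.1, s.2) :: p
    else s :: insertTerm t p

/-- Collects equal terms. -/
def collect (p : Pol) : Pol := p.foldr insertTerm []

/-- The derivation `f` of a product of jet variables. -/
def derivMonomial (f : ℕ → Pol) : List ℕ → Pol
  | [] => []
  | v :: m => (f v).map (mulTerm (1, [], m)) ++ (derivMonomial f m).map (mulTerm (1, [], [v]))

/-- The derivation with value `f v` at the jet variable `v`. -/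
def deriv (f : ℕ → Pol) (p : Pol) : Pol :=
  p.flatMap fun t => (derivMonomial f t.2.2).map (mulTerm (t.1, t.2.1, []))

def totalDeriv (p : Pol) : Pol := collect (deriv (fun v => [(1, [], [v + 3])]) p)

/-- The prolongation of an evolutionary system. -/
def flow (p q₀ q₁ : Pol) (v : ℕ) : Pol :=
  totalDeriv^[v / 3] (if v % 3 = 0 then p else if v % 3 = 1 then q₀ else q₁)

def genPol : ScalarGen → Pol
  | .u k => [(1, [], [3 * k])]
  | .s m d => [(1, [], [3 * m + 1, 3 * (m + d) + 1]), (1, [], [3 * m + 2, 3 * (m + d) + 2])]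

def prodPol (l : List ScalarGen) : Pol := l.foldr (fun g p => mul (genPol g) p) [(1, [], [])]

/-- The combination of the polynomials in `L` with parameters `i, i + 1, …`. -/
def combination : ℕ → List Pol → Pol
  | _, [] => []
  | i, p :: L => p.map (mulTerm (1, [i], [])) ++ combination (i + 1) L

/-! ### Soundness of the list arithmetic -/

section denotation

variable (γ : ℕ → ℂ)

def Term.den (t : Term) : DiffPoly 2 :=
  C ((t.1 : ℂ) * (t.2.1.map γ).prod) * (t.2.2.map fun v => X (jet v)).prod

def den (p : Pol) : DiffPoly 2 := (p.map (Term.den γ)).sum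

@[simp] theorem den_nil : den γ [] = 0 := rfl

@[simp] theorem den_cons (t : Term) (p : Pol) : den γ (t :: p) = Term.den γ t + den γ p := by
  simp [den]

@[simp] theorem den_append (p q : Pol) : den γ (p ++ q) = den γ p + den γ q := by
  simp [den]

theorem insertNat_perm (a : ℕ) (l : List ℕ) : (insertNat a l).Perm (a :: l) := by
  induction l with
  | nil => exact .refl _
  | cons b l ih =>
    rw [insertNat]
    cases a.ble b
    · exact (ih.cons b).trans (.swap a b l)
    · exact .refl _

theorem eqList_iff {l m : List ℕ} : eqList l m = true ↔ l = m := by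
  induction l generalizing m with
  | nil => cases m <;> simp [eqList]
  | cons a l ih => cases m <;> simp [eqList, ih, Bool.cond_eq_ite]

theorem merge_perm (l₁ l₂ : List ℕ) : (merge l₁ l₂).Perm (l₁ ++ l₂) := by
  induction l₁ with
  | nil => exact .refl _
  | cons a l ih => exact (insertNat_perm a _).trans (ih.cons a)

theorem den_mulTerm (s t : Term) : Term.den γ (mulTerm s t) = Term.den γ s * Term.den γ t := by
  simp only [Term.den, mulTerm, ((merge_perm _ _).map _).prod_eq, List.map_append,
    List.prod_append, Int.cast_mul, C_mul]
  ring

theorem den_map_mulTerm (s : Term) (p : Pol) :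
    den γ (p.map (mulTerm s)) = Term.den γ s * den γ p := by
  induction p with
  | nil => simp
  | cons t p ih => simp [den_mulTerm, ih, mul_add]

theorem den_mul (p q : Pol) : den γ (mul p q) = den γ p * den γ q := by
  induction p with
  | nil => simp [mul]
  | cons t p ih =>
    rw [mul, List.flatMap_cons, den_append, den_map_mulTerm, ← mul, ih, den_cons, add_mul]

theorem den_insertTerm (t : Term) (p : Pol) :
    den γ (insertTerm t p) = Term.den γ t + den γ p := by
  induction p with
  | nil => rfl
  | cons s p ih =>
    rw [insertTerm, Bool.cond_eq_ite]
    split_ifs with h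
    · replace h : t.2 = s.2 := by
        simp only [Bool.and_eq_true, eqList_iff] at h
        exact Prod.ext h.2 h.1
      simp only [den_cons, Term.den, h, Int.cast_add, add_mul, C_add]
      ring
    · rw [den_cons, ih, den_cons]
      ring

theorem den_collect (p : Pol) : den γ (collect p) = den γ p := by
  induction p with
  | nil => rfl
  | cons t p ih => rw [den_cons, ← ih]; exact den_insertTerm γ t _

/-- A derivation over `ℂ` is fixed by its values on the jet variables, and `derivMonomial` is the
Leibniz rule; the total derivative and both flows are instances. -/
theorem den_deriv (δ : Derivation ℂ (DiffPoly 2) (DiffPoly 2)) (f : ℕ → Pol)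
    (hf : ∀ v, δ (X (jet v)) = den γ (f v)) (p : Pol) : den γ (deriv f p) = δ (den γ p) := by
  have hm (m : List ℕ) : den γ (derivMonomial f m) = δ (m.map fun v => X (jet v)).prod := by
    induction m with
    | nil => simp [derivMonomial]
    | cons v m ih =>
      simp only [derivMonomial, den_append, den_map_mulTerm, ih, ← hf, List.map_cons,
        List.prod_cons, Derivation.leibniz, smul_eq_mul, Term.den]
      simp
      ring
  induction p with
  | nil => simp [deriv]
  | cons t p ih =>
    rw [deriv, List.flatMap_cons, den_append, den_map_mulTerm, ← deriv, ih, hm, den_cons, map_add]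
    congr 1
    simp only [Term.den, ← smul_eq_C_mul, Derivation.map_smul]
    simp

theorem totalDeriv_jet (v : ℕ) : CoupledEvolution.totalDeriv 2 (X (jet v)) = X (jet (v + 3)) := by
  have h₁ : (v + 3) % 3 = v % 3 := by omega
  have h₂ : (v + 3) / 3 = v / 3 + 1 := by omega
  rw [CoupledEvolution.totalDeriv, mkDerivation_X, jet, jet, h₁, h₂]
  split_ifs <;> rfl

theorem den_totalDeriv_iterate (n : ℕ) (p : Pol) :
    den γ (totalDeriv^[n] p) = (CoupledEvolution.totalDeriv 2)^[n] (den γ p) := by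
  induction n generalizing p with
  | zero => rfl
  | succ n ih =>
    rw [Function.iterate_succ_apply, ih, Function.iterate_succ_apply, totalDeriv, den_collect,
      den_deriv γ (CoupledEvolution.totalDeriv 2) _ (fun v => by simp [totalDeriv_jet, Term.den])]

theorem timeDeriv_den (S : EvolutionSystem) {p q₀ q₁ : Pol} (hp : den γ p = S.scalarRHS 2)
    (h₀ : den γ q₀ = S.vectorRHS 2 0) (h₁ : den γ q₁ = S.vectorRHS 2 1) (r : Pol) :
    S.timeDeriv 2 (den γ r) = den γ (deriv (flow p q₀ q₁) r) := by
  refine (den_deriv γ _ _ (fun v => ?_) r).symm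
  rw [flow, den_totalDeriv_iterate, EvolutionSystem.timeDeriv, mkDerivation_X, jet]
  split_ifs <;> simp [hp, h₀, h₁]

theorem den_genPol (g : ScalarGen) : den γ (genPol g) = g.toDiffPoly 2 := by
  have e₀ (m : ℕ) : jet (3 * m) = .u m := by
    rw [jet, if_pos (by omega)]; congr 1; omega
  have e₁ (m : ℕ) : jet (3 * m + 1) = .U 0 m := by
    rw [jet, if_neg (by omega), if_pos (by omega)]; congr 1; omega
  have e₂ (m : ℕ) : jet (3 * m + 2) = .U 1 m := by
    rw [jet, if_neg (by omega), if_neg (by omega)]; congr 1; omega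
  cases g <;> simp [genPol, ScalarGen.toDiffPoly, Term.den, e₀, e₁, e₂]

theorem den_prodPol (l : List ScalarGen) :
    den γ (prodPol l) = ScalarPoly.toDiffPoly 2 (l.map X).prod := by
  induction l with
  | nil => simp [prodPol, Term.den]
  | cons g l ih =>
    rw [prodPol, List.foldr_cons, ← prodPol, den_mul, ih, den_genPol, List.map_cons,
      List.prod_cons, map_mul]
    simp [ScalarPoly.toDiffPoly]

theorem den_combination {ι : Type} (f : ι → ℂ) (g : ι → Pol) (L : List ι) (i : ℕ)
    (h : ∀ (j : ℕ) (hj : j < L.length), γ (i + j) = f L[j]) :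
    den γ (combination i (L.map g)) = (L.map fun l => C (f l) * den γ (g l)).sum := by
  induction L generalizing i with
  | nil => simp [combination]
  | cons l L ih =>
    rw [List.map_cons, combination, den_append, den_map_mulTerm, List.map_cons, List.sum_cons,
      ih (i + 1) fun j hj => by
        rw [add_assoc, add_comm 1, h (j + 1) (by simpa using hj), List.getElem_cons_succ]]
    have := h 0 (by simp)
    simp_all [Term.den]

end denotation

/-! ### Coefficients -/

/-- The exponent vector of a product of variables. -/
def exponent {σ : Type} (l : List σ) : σ →₀ ℕ := (l.map fun v => Finsupp.single v 1).sum

theorem toMultiset_exponent {σ : Type} (l : List σ) : Finsupp.toMultiset (exponent l) = l := by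
  induction l with
  | nil => simp [exponent]
  | cons v l ih =>
    rw [exponent, List.map_cons, List.sum_cons, ← exponent, map_add, ih, Finsupp.toMultiset_single,
      one_smul, Multiset.singleton_add, Multiset.cons_coe]

theorem exponent_inj {σ : Type} {l₁ l₂ : List σ} : exponent l₁ = exponent l₂ ↔ l₁.Perm l₂ := by
  classical
  rw [← Multiset.coe_eq_coe, ← toMultiset_exponent, ← toMultiset_exponent]
  exact Multiset.toFinsupp.symm.injective.eq_iff.symm

theorem prod_X {σ : Type} (l : List σ) :
    (l.map X).prod = (monomial (exponent l) 1 : MvPolynomial σ ℂ) := by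
  induction l with
  | nil => rfl
  | cons v l ih =>
    rw [List.map_cons, List.prod_cons, ih, X, monomial_mul, one_mul, exponent, exponent,
      List.map_cons, List.sum_cons]

/-- A number that determines whether two lists of jet variables can be equal up to order. -/
def key (m : List ℕ) : ℕ := m.foldr (fun v n => (Nat.pow 8 v).add n) 0

/-- The coefficient of a product of jet variables. -/
def coefficient (m : List ℕ) (p : Pol) : Pol :=
  p.filter fun t => key t.2.2 == key m && t.2.2.isPerm m

theorem jet_injective : Function.Injective jet := by
  intro v w h
  unfold jet at h
  split_ifs at h <;> simp at h <;> omega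

-- Monomials are compared up to permutation, so no sortedness of the lists has to be maintained or
-- proved.
open Classical in
theorem coeff_den (γ : ℕ → ℂ) (m : List ℕ) (p : Pol) :
    coeff (exponent (m.map jet)) (den γ p) =
      ((coefficient m p).map fun t => (t.1 : ℂ) * (t.2.1.map γ).prod).sum := by
  induction p with
  | nil => simp [coefficient]
  | cons t p ih =>
    have hX : (t.2.2.map fun v => (X (jet v) : DiffPoly 2)).prod =
        monomial (exponent (t.2.2.map jet)) 1 := by
      rw [← prod_X, List.map_map]; rfl
    have hkey : t.2.2.Perm m → key t.2.2 = key m := fun h =>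
      h.foldr_eq' (fun a _ b _ n => by simp only [Nat.add_eq, Nat.add_left_comm]) 0
    have hexp : exponent (t.2.2.map jet) = exponent (m.map jet) ↔ t.2.2.Perm m := by
      rw [exponent_inj, List.map_perm_map_iff jet_injective]
    rw [den_cons, coeff_add, ih, Term.den, hX, coeff_C_mul, coeff_monomial, coefficient,
      coefficient, List.filter_cons]
    by_cases h : t.2.2.Perm m
    · simp [h, hexp, hkey h, List.isPerm_iff]
    · simp [h, hexp, List.isPerm_iff]

/-- Tests whether `m` has the coefficient `∑ z γᵢ γⱼ`, where `(z, i, j)` runs through `row`. -/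
def hasCoefficient (p : Pol) (m : List ℕ) (row : List (ℤ × ℕ × ℕ)) : Bool :=
  (collect ((coefficient m p).map (fun t => (t.1, t.2.1, [])) ++
    row.map fun r => (-r.1, [r.2.1, r.2.2], []))).all fun t => t.1 == 0

/-- The test subtracts the claimed row from the computed coefficient and finds only zero integers
after collecting. The two therefore agree for every value of the parameters, and vanishing of the
polynomial becomes vanishing of the row. -/
theorem sum_eq_zero_of_hasCoefficient (γ : ℕ → ℂ) {p : Pol} (hp : den γ p = 0) {m : List ℕ}
    {row : List (ℤ × ℕ × ℕ)} (h : hasCoefficient p m row = true) :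
    (row.map fun r => (r.1 : ℂ) * γ r.2.1 * γ r.2.2).sum = 0 := by
  have hzero (q : Pol) (hq : ∀ t ∈ q, t.1 = 0) : den γ q = 0 := by
    refine List.sum_eq_zero fun x hx => ?_
    obtain ⟨t, ht, rfl⟩ := List.mem_map.1 hx
    simp [Term.den, hq t ht]
  have h₁ : den γ (collect ((coefficient m p).map (fun t => (t.1, t.2.1, [])) ++
      row.map fun r => (-r.1, [r.2.1, r.2.2], []))) = 0 :=
    hzero _ fun t ht => by simpa using List.all_eq_true.1 h t ht
  have h₂ (q : Pol) : den γ (q.map fun t => (t.1, t.2.1, [])) =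
      C (q.map fun t => (t.1 : ℂ) * (t.2.1.map γ).prod).sum := by
    induction q with
    | nil => simp
    | cons t q ih => simp [Term.den, ih]
  have h₃ : den γ (row.map fun r => (-r.1, [r.2.1, r.2.2], [])) =
      -C (row.map fun r => (r.1 : ℂ) * γ r.2.1 * γ r.2.2).sum := by
    clear h h₁
    induction row with
    | nil => simp
    | cons t q ih => simp [Term.den, ih, mul_assoc]; ring
  rw [den_collect, den_append, h₂, h₃, ← coeff_den, hp, coeff_zero, C_0, zero_add, neg_eq_zero] at h₁
  exact C_injective _ _ (h₁.trans C_0.symm)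

/-! ### The commutator of a second order system and a symmetry of order four -/

/-- The terms of weight `5`. -/
def scalarTerms : List (List ScalarGen) :=
  [[.u 0, .u 0, .u 0, .u 0, .u 0], [.u 0, .u 0, .u 0, .u 1], [.u 0, .u 0, .u 0, .s 0 0], [.u 0, .u
   0, .u 2], [.u 0, .u 0, .s 0 1], [.u 0, .u 1, .u 1], [.u 0, .u 1, .s 0 0], [.u 0, .u 3], [.u 0,
   .s 0 0, .s 0 0], [.u 0, .s 0 2], [.u 0, .s 1 0], [.u 1, .u 2], [.u 1, .s 0 1], [.u 2, .s 0 0],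
   [.u 4], [.s 0 0, .s 0 1], [.s 0 3], [.s 1 1]]

/-- The terms `M ∂ₓᵏ U` of weight `5`, as pairs of `k` and `M`. -/
def vectorTerms : List (ℕ × List ScalarGen) :=
  [(4, []), (3, [.u 0]), (2, [.u 0, .u 0]), (2, [.u 1]), (2, [.s 0 0]), (1, [.u 0, .u 0, .u 0]),
   (1, [.u 0, .u 1]), (1, [.u 0, .s 0 0]), (1, [.u 2]), (1, [.s 0 1]), (0, [.u 0, .u 0, .u 0, .u
   0]), (0, [.u 0, .u 0, .u 1]), (0, [.u 0, .u 0, .s 0 0]), (0, [.u 0, .u 2]), (0, [.u 0, .s 0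
   1]), (0, [.u 1, .u 1]), (0, [.u 1, .s 0 0]), (0, [.u 3]), (0, [.s 0 0, .s 0 0]), (0, [.s 0 2]),
   (0, [.s 1 0])]

/-- The component `e` of the term `M ∂ₓᵏ U`. -/
def vectorTerm (e : ℕ) (t : ℕ × List ScalarGen) : Pol :=
  (prodPol t.2).map (mulTerm (1, [], [3 * t.1 + e + 1]))

def systemScalar : Pol :=
  combination 1 ([[.u 2], [.u 0, .u 1], [.u 0, .u 0, .u 0], [.u 0, .s 0 0], [.s 0 1]].map prodPol)

def systemVector (e : ℕ) : Pol :=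
  combination 6 ([(2, []), (0, [.u 1]), (1, [.u 0]), (0, [.u 0, .u 0]), (0, [.s 0 0])].map
    (vectorTerm e))

def symmetryScalar : Pol := combination 33 (scalarTerms.map prodPol)

def symmetryVector (e : ℕ) : Pol := combination 65 (vectorTerms.map (vectorTerm e))

/-- The commutator `∂_t q - ∂_τ p`. -/
def commutator (p q : Pol) : Pol :=
  deriv (flow systemScalar (systemVector 0) (systemVector 1)) q ++
    (deriv (flow symmetryScalar (symmetryVector 0) (symmetryVector 1)) p).map
      (mulTerm (-1, [], []))

/-- Coefficients of `∂_t (u_τ) - ∂_τ (u_t)`: a monomial, and the terms `(z, i, j)` of its coefficient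
`∑ z γᵢ γⱼ`. -/
def scalarTable : List (List ℕ × List (ℤ × ℕ × ℕ)) :=
  [([1, 16], [(-1, 1, 49), (1, 5, 47), (-1, 5, 65), (1, 6, 49)]), ([4, 13], [(-2, 1, 49), (-1, 1,
   50), (5, 5, 47), (-1, 5, 65), (1, 6, 50)]), ([7, 10], [(-1, 1, 49), (-3, 1, 50), (10, 5, 47),
   (1, 6, 49), (1, 6, 50)]), ([3, 12], [(-2, 1, 40), (4, 2, 47)]), ([6, 9], [(-2, 1, 44), (10, 2,
   47)]), ([0, 1, 13], [(-1, 1, 42), (-1, 2, 49), (2, 4, 47), (-2, 4, 65), (1, 5, 40), (-1, 5,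
   66), (1, 6, 42), (1, 8, 49)]), ([0, 4, 10], [(-2, 1, 42), (-2, 1, 43), (-1, 2, 49), (-1, 2,
   50), (8, 4, 47), (4, 5, 40), (-1, 5, 66), (2, 6, 43), (1, 8, 49), (1, 8, 50)]), ([1, 3, 10],
   [(-2, 1, 42), (-1, 1, 45), (-1, 2, 49), (8, 4, 47), (1, 5, 44), (-1, 5, 66), (-1, 5, 68), (1,
   6, 45), (2, 7, 49), (3, 8, 49)]), ([1, 6, 7], [(-2, 1, 45), (-2, 1, 46), (12, 4, 47), (1, 5,
   44), (-1, 5, 68), (-1, 5, 73), (2, 6, 46), (3, 7, 49), (1, 7, 50), (3, 8, 49)]), ([1, 1, 2,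
   11], [(-1, 1, 48), (4, 10, 49), (-1, 4, 49), (1, 5, 46), (-1, 5, 84), (-1, 5, 69), (1, 6,
   48)]), ([1, 1, 5, 8], [(-3, 1, 48), (6, 10, 49), (2, 10, 50), (-1, 4, 50), (3, 5, 46), (-1, 5,
   84), (-2, 5, 85), (-1, 5, 69), (1, 6, 48)]), ([1, 2, 4, 8], [(-6, 1, 48), (12, 10, 49), (4, 10,
   50), (1, 5, 42), (1, 5, 45), (-2, 5, 74), (-2, 5, 84), (-2, 5, 69), (2, 6, 48)]), ([0, 7, 7],
   [(-1, 1, 42), (-2, 1, 43), (-1, 2, 50), (6, 4, 47), (3, 5, 40), (1, 6, 42), (1, 8, 50)]), ([1,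
   4, 9], [(-4, 1, 46), (8, 4, 47), (1, 5, 40), (-2, 5, 82), (-1, 5, 73), (3, 7, 49), (1, 7, 50),
   (1, 8, 49)]), ([4, 4, 6], [(-2, 1, 45), (-2, 1, 46), (12, 4, 47), (1, 5, 44), (-1, 5, 73), (2,
   7, 50), (1, 8, 50)]), ([0, 3, 9], [(-4, 1, 36), (3, 2, 40), (24, 3, 47)]), ([0, 6, 6], [(-2, 1,
   38), (3, 2, 40), (18, 3, 47)]), ([0, 1, 1, 9], [(1, 4, 40), (-2, 4, 82), (-1, 5, 78), (1, 7,
   42), (2, 9, 49)]), ([0, 0, 1, 10], [(-1, 1, 37), (-1, 2, 42), (-3, 3, 49), (2, 4, 40), (-2, 4,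
   66), (1, 5, 36), (-1, 5, 67), (1, 6, 37), (1, 8, 42), (2, 9, 49)]), ([0, 1, 3, 7], [(-4, 1,
   37), (-2, 1, 39), (-1, 2, 42), (-1, 2, 45), (2, 4, 44), (6, 4, 40), (-2, 4, 68), (2, 5, 38),
   (-2, 5, 67), (-1, 5, 71), (2, 6, 39), (2, 7, 42), (2, 8, 42), (1, 8, 45), (6, 9, 49), (2, 9,
   50)]), ([0, 1, 4, 6], [(-4, 1, 39), (-2, 2, 46), (2, 4, 44), (6, 4, 40), (-2, 4, 73), (2, 5,
   36), (-2, 5, 78), (-1, 5, 71), (2, 7, 42), (2, 7, 43), (1, 8, 42), (2, 8, 46), (6, 9, 49), (2,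
   9, 50)]), ([1, 1, 3, 6], [(-2, 1, 39), (2, 2, 46), (1, 4, 44), (-1, 5, 78), (-2, 5, 80), (1, 7,
   45), (2, 7, 46), (6, 9, 49)]), ([1, 1, 1, 1, 6], [(2, 10, 46), (-1, 5, 81), (1, 7, 48)]), ([1,
   1, 2, 3, 5], [(-8, 1, 41), (4, 10, 45), (-1, 2, 48), (4, 4, 46), (1, 5, 39), (-1, 5, 79), (-4,
   5, 81), (-1, 5, 72), (4, 7, 48), (1, 8, 48)]), ([0, 1, 1, 2, 8], [(-4, 1, 41), (4, 10, 42),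
   (-1, 2, 48), (2, 4, 46), (-2, 4, 84), (-2, 4, 69), (1, 5, 39), (-1, 5, 79), (-1, 5, 72), (4, 6,
   41), (1, 8, 48)]), ([0, 0, 0, 9], [(1, 3, 40)]), ([0, 0, 0, 0, 6], [(2, 3, 36)])]

/-- Coefficients of `∂_t ((U₁)_τ) - ∂_τ ((U₁)_t)`. -/
def vectorTable : List (List ℕ × List (ℤ × ℕ × ℕ)) :=
  [([3, 13], [(-2, 6, 66), (4, 8, 65)]), ([6, 10], [(1, 1, 66), (-1, 6, 66), (-2, 6, 68), (4, 7,
   65), (6, 8, 65)]), ([7, 9], [(1, 1, 68), (-1, 6, 68), (-2, 6, 73), (6, 7, 65), (4, 8, 65)]),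
   ([4, 12], [(1, 1, 73), (-2, 6, 82), (-1, 6, 73), (4, 7, 65), (-1, 8, 47), (1, 8, 65)]), ([1,
   15], [(1, 1, 82), (-1, 6, 82), (-1, 7, 47), (1, 7, 65)]), ([2, 5, 10], [(8, 10, 65), (1, 5,
   66), (-4, 6, 69)]), ([2, 7, 8], [(12, 10, 65), (1, 5, 68), (-2, 6, 74)]), ([5, 5, 7], [(12, 10,
   65), (1, 5, 68), (-2, 6, 74), (-2, 6, 69)]), ([2, 4, 11], [(8, 10, 65), (1, 5, 73), (-2, 6,
   84), (-1, 8, 49)]), ([4, 5, 8], [(24, 10, 65), (3, 5, 73), (-2, 6, 74), (-2, 6, 84), (-4, 6,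
   85), (-1, 8, 50)]), ([1, 2, 14], [(1, 5, 82), (-1, 7, 49)]), ([1, 5, 11], [(8, 10, 65), (4, 5,
   82), (-2, 6, 84), (-1, 7, 49), (-1, 7, 50)]), ([1, 8, 8], [(6, 10, 65), (3, 5, 82), (-2, 6,
   85), (-1, 7, 50)]), ([0, 2, 2, 10], [(1, 4, 66)]), ([0, 3, 10], [(1, 2, 66), (-4, 6, 67), (2,
   8, 66), (8, 9, 65)]), ([0, 6, 7], [(2, 1, 67), (1, 2, 68), (-2, 6, 67), (-2, 6, 71), (3, 7,
   66), (3, 8, 66), (-1, 8, 68), (12, 9, 65)]), ([0, 1, 12], [(1, 1, 78), (1, 2, 82), (-1, 6, 78),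
   (-1, 7, 40), (1, 7, 66), (-1, 8, 82), (-2, 9, 47), (2, 9, 65)]), ([1, 3, 9], [(2, 1, 80), (4,
   2, 82), (-2, 6, 78), (-2, 6, 80), (-1, 7, 44), (-1, 7, 40), (1, 7, 68), (8, 9, 65)]), ([1, 6,
   6], [(1, 1, 78), (3, 2, 82), (-1, 6, 78), (-2, 6, 80), (-1, 7, 44), (1, 7, 73), (6, 9, 65)]),
   ([0, 4, 9], [(1, 1, 71), (1, 2, 73), (-2, 6, 78), (-1, 6, 71), (3, 7, 66), (-1, 8, 40), (1, 8,
   66), (-1, 8, 73), (8, 9, 65)]), ([3, 4, 6], [(1, 1, 71), (3, 2, 73), (-2, 6, 78), (-4, 6, 80),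
   (-3, 6, 71), (2, 7, 68), (-1, 8, 44), (1, 8, 68), (1, 8, 73), (24, 9, 65)]), ([1, 2, 2, 2, 8],
   [(2, 10, 84), (1, 5, 81), (-1, 7, 48)]), ([2, 2, 3, 7], [(1, 4, 68), (-2, 6, 72), (2, 7, 69),
   (2, 8, 69)]), ([1, 2, 3, 8], [(6, 4, 82), (2, 5, 80), (-2, 6, 79), (-1, 7, 42), (-1, 7, 45),
   (2, 7, 84), (2, 8, 84)]), ([1, 2, 5, 6], [(1, 1, 79), (6, 4, 82), (1, 5, 78), (-1, 6, 79), (-4,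
   6, 81), (-1, 7, 45), (-2, 7, 46), (1, 7, 74), (2, 7, 84), (2, 7, 85), (1, 8, 84)]), ([2, 3, 4,
   5], [(4, 10, 68), (4, 4, 73), (1, 5, 71), (-2, 6, 79), (-4, 6, 81), (-4, 6, 72), (2, 7, 74),
   (-1, 8, 45), (2, 8, 74)]), ([2, 2, 4, 6], [(1, 1, 72), (1, 4, 73), (-2, 6, 81), (-1, 6, 72),
   (1, 7, 74), (2, 7, 69), (-1, 8, 46), (1, 8, 69)]), ([1, 2, 2, 9], [(1, 1, 81), (-2, 10, 82),
   (1, 4, 82), (-1, 6, 81), (-1, 7, 46), (1, 7, 84), (1, 7, 69)]), ([3, 3, 7], [(1, 2, 68), (-2,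
   6, 67), (-2, 6, 71), (2, 8, 68), (12, 9, 65)]), ([1, 2, 2, 3, 3], [(-2, 10, 80), (1, 2, 81),
   (2, 4, 80), (-2, 6, 77), (-1, 7, 39), (2, 7, 81), (2, 9, 84), (2, 9, 69)]), ([0, 0, 0, 10],
   [(1, 3, 66)]), ([0, 0, 2, 2, 7], [(2, 4, 67), (2, 9, 69)])]

/-- The tables need not exhaust the commutator: only the coefficients used in the classification are
listed. -/
theorem scalarTable_correct :
    scalarTable.all (fun r => hasCoefficient (commutator systemScalar symmetryScalar) r.1 r.2) =
      true := by
  decide +kernel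

theorem vectorTable_correct :
    vectorTable.all (fun r =>
      hasCoefficient (commutator (systemVector 0) (symmetryVector 0)) r.1 r.2) = true := by
  decide +kernel

end Reflection

/-! ### The determining equations: algebra -/

namespace Determining

-- `hᵢ` and `kᵢ` follow the order of `scalarTerms` and `vectorTerms`. Each equation is named after
-- its monomial, all digits being orders of derivatives: `s13u0` belongs to `⟨U_x, U_xxx⟩ u`, and
-- `U3s00u0` to `u ⟨U,U⟩ U_xxx`.
variable {a₁ a₂ a₃ a₄ a₅ a₇ a₈ a₉ a₁₀ h₄ h₅ h₆ h₇ h₈ h₉ h₁₀ h₁₁ h₁₂ h₁₃ h₁₄ h₁₅ h₁₆ h₁₇ h₁₈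
  k₁ k₂ k₃ k₄ k₅ k₇ k₈ k₉ k₁₀ k₁₄ k₁₅ k₁₆ k₁₇ k₁₈ k₂₀ k₂₁ : ℂ}

/-- If `a₁ = 1` and `a₆ = 0`, then the symmetry has no term `∂ₓ⁴ U`. -/
theorem fourth_vanishes (hu : a₄ ≠ 0 ∨ a₅ ≠ 0) (hU : a₇ ≠ 0 ∨ a₈ ≠ 0 ∨ a₉ ≠ 0)
    (s05 : a₅ * h₁₅ - a₅ * k₁ - h₁₇ = 0)
    (s14 : 5 * a₅ * h₁₅ - a₅ * k₁ - 2 * h₁₇ - h₁₈ = 0)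
    (s23 : 10 * a₅ * h₁₅ - h₁₇ - 3 * h₁₈ = 0)
    (U4u1 : 4 * a₈ * k₁ = 0)
    (U3u2 : 4 * a₇ * k₁ + 6 * a₈ * k₁ + k₂ = 0)
    (U3s00u0 : a₄ * k₂ = 0)
    (U3u0u1 : a₂ * k₂ + 2 * a₈ * k₂ + 8 * a₉ * k₁ = 0) : k₁ = 0 := by
  by_contra hk
  -- In symbols, `(ξ+η)² B = A (h₁₅(ξ+η)⁴ - k₁(ξ⁴+η⁴))` with `A = a₅(ξ+η)/2`. As `ξ+η` does not
  -- divide `ξ⁴+η⁴`, this forces `a₅ k₁ = 0`.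
  obtain rfl : 0 = a₅ := by
    refine (mul_right_cancel₀ hk ?_).symm
    linear_combination (3 / 2) * s14 - (1 / 2) * s23 - (5 / 2) * s05
  obtain rfl : 0 = a₈ := (mul_right_cancel₀ hk (by linear_combination U4u1 / 4)).symm
  have ha₄ : a₄ ≠ 0 := by simpa using hu
  obtain rfl : 0 = k₂ := (mul_left_cancel₀ ha₄ (by linear_combination U3s00u0)).symm
  obtain rfl : 0 = a₇ := (mul_right_cancel₀ hk (by linear_combination U3u2 / 4)).symm
  obtain rfl : 0 = a₉ := (mul_right_cancel₀ hk (by linear_combination U3u0u1 / 8)).symm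
  simp at hU

/-- The equations with `a₁ = 1`, `a₆ = 0` that are of degree at most three in `u`, `U`. -/
theorem scalar_order_two (hU : a₇ ≠ 0 ∨ a₈ ≠ 0 ∨ a₉ ≠ 0)
    (U3u2 : k₂ = 0)
    (U2u3 : k₄ = 0)
    (U1u4 : k₉ - a₈ = 0)
    (U0u5 : k₁₈ - a₇ = 0)
    (U2u0u2 : a₂ * k₄ + 3 * a₇ * k₂ + 3 * a₈ * k₂ + 2 * k₃ - a₈ * k₄ = 0)
    (u1u4 : 4 * a₂ - 2 * h₈ = 0)
    (u2u3 : 10 * a₂ - 2 * h₁₂ = 0)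
    (u0u1u3 : 3 * a₂ * h₈ + 24 * a₃ - 4 * h₄ = 0)
    (u0u2u2 : 3 * a₂ * h₈ + 18 * a₃ - 2 * h₆ = 0)
    (u0u0u0u3 : a₃ * h₈ = 0)
    (u0u0u0u0u2 : 2 * a₃ * h₄ = 0)
    (s05 : a₅ - h₁₇ = 0)
    (s14 : 5 * a₅ - 2 * h₁₇ - h₁₈ = 0)
    (s04u0 : 2 * a₄ + a₅ * h₈ + a₈ * h₁₇ - a₂ * h₁₇ - a₅ * k₂ - h₁₀ = 0)
    (s13u0 : 8 * a₄ + 4 * a₅ * h₈ + a₈ * h₁₇ + a₈ * h₁₈ - a₂ * h₁₇ - a₂ * h₁₈ - a₅ * k₂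
      - 2 * h₁₀ - 2 * h₁₁ = 0)
    (s03u1 : 8 * a₄ + a₅ * h₁₂ + 2 * a₇ * h₁₇ + 3 * a₈ * h₁₇ - a₂ * h₁₇ - a₅ * k₂ - a₅ * k₄
      - 2 * h₁₀ - h₁₃ = 0)
    (s02u2 : 12 * a₄ + a₅ * h₁₂ + 3 * a₇ * h₁₇ + a₇ * h₁₈ + 3 * a₈ * h₁₇ - a₅ * k₄ - a₅ * k₉
      - 2 * h₁₃ - 2 * h₁₄ = 0)
    (U0u0u4 : a₂ * k₁₈ + a₇ * k₂ + k₁₄ - a₇ * h₈ - a₈ * k₁₈ - 2 * a₉ = 0)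
    (U0u1u3 : 4 * a₂ * k₁₈ + a₇ * k₄ + 2 * k₁₆ - a₇ * h₁₂ - a₇ * h₈ = 0)
    (U0u2u2 : 3 * a₂ * k₁₈ + a₇ * k₉ + k₁₄ - a₇ * h₁₂ = 0)
    (U1u0u3 : a₂ * k₉ + 3 * a₇ * k₂ + a₈ * k₂ + k₇ - a₈ * h₈ - a₈ * k₉ = 0)
    (U1u1u2 : 3 * a₂ * k₉ + 2 * a₇ * k₄ + a₈ * k₄ + a₈ * k₉ + k₇ - a₈ * h₁₂ = 0)
    (s00u0u3 : a₄ * h₈ + a₇ * h₁₀ + 2 * a₉ * h₁₇ - 2 * a₄ * k₁₈ - a₅ * k₁₄ = 0)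
    (s03u0u0 : 2 * a₄ * h₈ + a₅ * h₄ + a₈ * h₁₀ + 2 * a₉ * h₁₇ - a₂ * h₁₀ - 3 * a₃ * h₁₇
      - 2 * a₄ * k₂ - a₅ * k₃ - h₅ = 0)
    (s02u0u1 : 2 * a₄ * h₁₂ + 6 * a₄ * h₈ + 2 * a₅ * h₆ + 2 * a₇ * h₁₀ + 2 * a₈ * h₁₀ + a₈ * h₁₃
      + 6 * a₉ * h₁₇ + 2 * a₉ * h₁₈ - a₂ * h₁₀ - a₂ * h₁₃ - 2 * a₄ * k₄ - 2 * a₅ * k₃ - a₅ * k₇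
      - 4 * h₅ - 2 * h₇ = 0)
    (s01u0u2 : 2 * a₄ * h₁₂ + 6 * a₄ * h₈ + 2 * a₅ * h₄ + 2 * a₇ * h₁₀ + 2 * a₇ * h₁₁ + a₈ * h₁₀
      + 2 * a₈ * h₁₄ + 6 * a₉ * h₁₇ + 2 * a₉ * h₁₈ - 2 * a₂ * h₁₄ - 2 * a₄ * k₉ - 2 * a₅ * k₁₄
      - a₅ * k₇ - 4 * h₇ = 0)
    (s00u1u2 : 2 * a₂ * h₁₄ + a₄ * h₁₂ + a₇ * h₁₃ + 2 * a₇ * h₁₄ + 6 * a₉ * h₁₇ - a₅ * k₁₄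
      - 2 * a₅ * k₁₆ - 2 * h₇ = 0)
    (s00s03 : 4 * a₁₀ * h₁₇ + a₅ * h₁₄ - a₄ * h₁₇ - a₅ * k₂₀ - a₅ * k₅ - h₁₆ = 0)
    (s00s12 : 6 * a₁₀ * h₁₇ + 2 * a₁₀ * h₁₈ + 3 * a₅ * h₁₄ - a₄ * h₁₈ - a₅ * k₂₀
      - 2 * a₅ * k₂₁ - a₅ * k₅ - 3 * h₁₆ = 0)
    (s01s02 : 12 * a₁₀ * h₁₇ + 4 * a₁₀ * h₁₈ + a₅ * h₁₀ + a₅ * h₁₃ - 2 * a₅ * k₁₀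
      - 2 * a₅ * k₂₀ - 2 * a₅ * k₅ - 6 * h₁₆ = 0)
    (s00s00u2 : 2 * a₁₀ * h₁₄ + a₇ * h₁₆ - a₅ * k₁₇ = 0)
    (s00s01u1 : 4 * a₁₀ * h₁₃ + 4 * a₄ * h₁₄ + a₅ * h₇ + 4 * a₇ * h₁₆ + a₈ * h₁₆ - a₂ * h₁₆
      - a₅ * k₁₅ - 4 * a₅ * k₁₇ - a₅ * k₈ - 8 * h₉ = 0)
    (s00s02u0 : 4 * a₁₀ * h₁₀ + 2 * a₄ * h₁₄ + a₅ * h₇ + a₈ * h₁₆ - a₂ * h₁₆ - 2 * a₄ * k₂₀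
      - 2 * a₄ * k₅ - a₅ * k₁₅ - a₅ * k₈ - 4 * h₉ = 0)
    (U0s00s02 : 2 * a₁₀ * k₂₀ + a₅ * k₁₇ - a₇ * h₁₆ = 0)
    (U2s00u1 : a₄ * k₄ + 2 * a₇ * k₅ + 2 * a₈ * k₅ = 0)
    (U0s02u1 : 6 * a₄ * k₁₈ + 2 * a₅ * k₁₆ + 2 * a₇ * k₂₀ + 2 * a₈ * k₂₀ - a₇ * h₁₀ - a₇ * h₁₃ = 0)
    (U0s01u2 : 6 * a₄ * k₁₈ + a₅ * k₁₄ + a₇ * k₁₀ + 2 * a₇ * k₂₀ + 2 * a₇ * k₂₁ + a₈ * k₂₀ + k₁₅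
      - a₇ * h₁₃ - 2 * a₇ * h₁₄ = 0)
    (U1s01u1 : 4 * a₁₀ * k₄ + 4 * a₄ * k₉ + a₅ * k₇ + 2 * a₇ * k₁₀ + 2 * a₈ * k₁₀ - a₈ * h₁₃ = 0)
    (U1s00u2 : a₄ * k₉ + a₇ * k₁₀ + 2 * a₇ * k₅ + a₈ * k₅ + k₈ - a₈ * h₁₄ = 0)
    (U0s00u3 : a₄ * k₁₈ + a₇ * k₂₀ + a₇ * k₅ + k₁₇ - 2 * a₁₀ * k₁₈ - a₇ * h₁₄ = 0)
    (U0s00u1u1 : a₂ * k₁₇ + 2 * a₄ * k₁₆ + 2 * a₇ * k₁₇ + 2 * a₉ * k₂₀ + 2 * a₉ * k₅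
      - 2 * a₁₀ * k₁₆ - a₇ * h₇ = 0)
    (hu : a₄ ≠ 0 ∨ a₅ ≠ 0) :
    a₃ = 0 ∧ a₄ = 0 ∧ a₅ ≠ 0 ∧
      (a₈ ≠ 0 ∧ a₂ = 2 * a₈ ∧ a₇ = a₈ / 2 ∧ a₉ = 0 ∧ a₁₀ = 0 ∨
        a₇ ≠ 0 ∧ a₈ = 0 ∧ a₂ = -4 * a₇ ∧ a₉ = -2 * a₇ ^ 2 ∧ a₁₀ = a₅ * a₇ / 2) := by
  subst U3u2 U2u3
  obtain rfl : a₈ = k₉ := by linear_combination -U1u4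
  obtain rfl : a₇ = k₁₈ := by linear_combination -U0u5
  obtain rfl : 0 = k₃ := by linear_combination -U2u0u2 / 2
  obtain rfl : 2 * a₂ = h₈ := by linear_combination u1u4 / 2
  obtain rfl : 5 * a₂ = h₁₂ := by linear_combination u2u3 / 2
  -- With `U = 0` the scalar equation must have the symmetry by itself. The combination eliminates
  -- `h₄` and leaves `a₃² = 0`, so only the Burgers equation or the heat equation remains.
  obtain rfl : 0 = a₃ := by
    refine (pow_eq_zero_iff two_ne_zero).1 ?_ |>.symm
    linear_combination (u0u0u0u0u2 - (3 * a₂ / 2) * u0u0u0u3 + a₃ / 2 * u0u1u3) / 12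
  obtain rfl : 3 / 2 * a₂ ^ 2 = h₄ := by linear_combination u0u1u3 / 4
  obtain rfl : 3 * a₂ ^ 2 = h₆ := by linear_combination u0u2u2 / 2
  obtain rfl : a₅ = h₁₇ := by linear_combination s05
  obtain rfl : 3 * a₅ = h₁₈ := by linear_combination s14
  obtain rfl : 2 * a₄ + a₂ * a₅ + a₈ * a₅ = h₁₀ := by linear_combination s04u0
  obtain rfl : 2 * a₄ + a₂ * a₅ + a₈ * a₅ = h₁₁ := by linear_combination s13u0 / 2
  obtain rfl : 4 * a₄ + 2 * a₂ * a₅ + 2 * a₇ * a₅ + a₈ * a₅ = h₁₃ := by linear_combination s03u1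
  obtain rfl : 2 * a₄ + a₂ * a₅ / 2 + a₇ * a₅ = h₁₄ := by linear_combination s02u2 / 2
  obtain rfl : 2 * a₂ * a₇ - a₇ * a₈ = k₁₄ := by linear_combination -U0u2u2
  obtain rfl : 3 / 2 * a₂ * a₇ = k₁₆ := by linear_combination -U0u1u3 / 2
  obtain rfl : a₂ * a₈ + a₈ ^ 2 = k₇ := by linear_combination -U1u0u3
  obtain rfl : a₇ * (a₂ - 2 * a₈) / 2 = a₉ := by linear_combination U0u0u4 / 2
  -- These two product relations organize the rest: `a₈ = 0` leads to system B, while `a₈ ≠ 0` gives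
  -- `a₂ = 2a₈` and `a₄ = 0` and leads to system C.
  have ha₂a₄ : a₂ * a₄ = 0 := by linear_combination s00u0u3 / 2
  have ha₂a₈ : a₈ * (a₂ - 2 * a₈) = 0 := by linear_combination -U1u1u2
  clear U1u4 U0u5 U2u0u2 u1u4 u2u3 u0u0u0u3 u0u0u0u0u2 u0u1u3 u0u2u2 s05 s14 s04u0 s13u0 s03u1 s02u2
    U0u2u2 U0u1u3 U1u0u3 U1u1u2 U0u0u4 s00u0u3
  rw [mul_eq_zero] at ha₂a₄ ha₂a₈
  refine ⟨rfl, ?_⟩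
  by_cases h₀ : a₈ = 0
  · obtain rfl := h₀.symm
    clear ha₂a₈
    have ha₇ : a₇ ≠ 0 := by
      rintro rfl
      simp at hU
    obtain rfl : 0 = k₅ := (mul_left_cancel₀ ha₇ (by linear_combination U2s00u1 / 2)).symm
    obtain rfl : 0 = k₁₀ := (mul_left_cancel₀ ha₇ (by linear_combination U1s01u1 / 2)).symm
    obtain rfl : 0 = k₈ := by linear_combination -U1s00u2
    have hzero : a₂ * a₄ = 0 := mul_eq_zero.2 ha₂a₄
    obtain rfl : a₂ ^ 2 * a₅ / 2 + a₂ * a₅ * a₇ = h₅ := by linear_combination s03u0u0 - 2 * hzero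
    obtain rfl : a₂ ^ 2 * a₅ / 2 + a₂ * a₅ * a₇ + 2 * a₄ * a₇ = h₇ := by
      linear_combination s02u0u1 / 2 - 8 * hzero
    have hlin : 4 * a₄ + a₂ * a₅ + 4 * a₅ * a₇ = 0 := by
      refine mul_left_cancel₀ ha₇ ?_
      linear_combination s00u1u2 - 9 * hzero
    have ha₅ : a₅ ≠ 0 := by
      rintro rfl
      simp_all
    obtain rfl : 4 * a₁₀ * a₅ + a₅ * (a₄ + a₂ * a₅ / 2 + a₇ * a₅ - k₂₀) = h₁₆ := by
      linear_combination s00s03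
    obtain rfl : k₂₀ = k₂₁ := mul_left_cancel₀ ha₅ (by linear_combination s00s12 / 2)
    obtain rfl : a₅ * a₇ = k₂₀ := mul_left_cancel₀ ha₅ (by linear_combination -s01s02 / 4)
    obtain rfl : a₇ * (2 * a₁₀ + a₄ + a₂ * a₅ / 2) = k₁₇ := by linear_combination -U0s00u3
    obtain rfl : a₇ * (2 * a₄ + a₂ * a₅) = k₁₅ := by linear_combination -U0s01u2
    -- If `a₂ = 0`, then both `4a₁₀ = a₅a₇` and `a₁₀ = 0` follow, contrary to `a₅, a₇ ≠ 0`.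
    rcases ha₂a₄ with rfl | rfl
    · obtain rfl : -(a₅ * a₇) = a₄ := by linear_combination -hlin / 4
      have h₁ : a₅ * a₇ * (4 * a₁₀ - a₅ * a₇) = 0 := by
        linear_combination (s00s01u1 - 2 * s00s02u0) / 4
      obtain rfl : 0 = a₁₀ :=
        (mul_left_cancel₀ (pow_ne_zero 2 ha₇) (by linear_combination U0s00u1u1 / 4)).symm
      simp_all
    · obtain rfl : -4 * a₇ = a₂ := mul_left_cancel₀ ha₅ (by linear_combination -hlin)
      refine ⟨rfl, ha₅, .inr ⟨ha₇, rfl, rfl, by ring, ?_⟩⟩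
      refine mul_left_cancel₀ (pow_ne_zero 2 ha₇) ?_
      linear_combination U0s00u1u1 / 8
  · obtain rfl : 2 * a₈ = a₂ := by linear_combination -ha₂a₈.resolve_left h₀
    obtain rfl : 0 = a₄ := by simpa [h₀, eq_comm] using ha₂a₄
    have ha₅ : a₅ ≠ 0 := by simpa using hu
    obtain rfl : 3 * a₅ * a₈ ^ 2 = h₅ := by linear_combination s03u0u0
    obtain rfl : 2 * a₅ * a₈ * (a₇ + a₈) = h₇ := by linear_combination s02u0u1 / 2
    obtain rfl : a₈ / 2 = a₇ := by
      refine mul_left_cancel₀ (mul_ne_zero ha₅ h₀) ?_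
      linear_combination s01u0u2 / 4
    obtain rfl : 0 = k₅ := (mul_left_cancel₀ h₀ (by linear_combination U2s00u1 / 3)).symm
    obtain rfl : a₅ * a₈ / 2 = k₂₀ := mul_left_cancel₀ h₀ (by linear_combination -U0s02u1 / 3)
    refine ⟨rfl, ha₅, .inl ⟨h₀, rfl, rfl, by ring, ?_⟩⟩
    refine mul_left_cancel₀ (mul_ne_zero ha₅ h₀) ?_
    linear_combination (s00s00u2 + U0s00s02) / 4

/-- If `a₆ = 1` and the symmetry has no term `∂ₓ⁴ U`, then the equation for `u` does not involve
`U`. -/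
theorem decoupled
    (s05 : a₅ + h₁₇ - a₁ * h₁₇ = 0)
    (s14 : 5 * a₅ + h₁₈ - 2 * a₁ * h₁₇ - a₁ * h₁₈ = 0)
    (s23 : 10 * a₅ + h₁₇ + h₁₈ - a₁ * h₁₇ - 3 * a₁ * h₁₈ = 0)
    (s04u0 : 2 * a₄ + a₅ * h₈ + a₈ * h₁₇ + h₁₀ - a₁ * h₁₀ - a₂ * h₁₇ - a₅ * k₂ = 0)
    (s13u0 : 8 * a₄ + 4 * a₅ * h₈ + a₈ * h₁₇ + a₈ * h₁₈ + 2 * h₁₁ - 2 * a₁ * h₁₀ - 2 * a₁ * h₁₁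
      - a₂ * h₁₇ - a₂ * h₁₈ - a₅ * k₂ = 0)
    (s22u0 : 6 * a₄ + 3 * a₅ * h₈ + a₈ * h₁₈ + h₁₀ - a₁ * h₁₀ - 2 * a₁ * h₁₁ - a₂ * h₁₈ = 0) :
    a₄ = 0 ∧ a₅ = 0 := by
  -- The symbol `a₁(ξ+η)² - ξ² - η²` would have to divide `a₅(ξ+η)⁵`, but it does not vanish on `ξ+η
  -- = 0` away from the origin. Hence `a₅ = 0` and `B = 0`.
  obtain rfl : 3 * h₁₇ = h₁₈ := by linear_combination (5 * s05 - 3 * s14 + s23) / 2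
  obtain rfl : 0 = h₁₇ := by linear_combination (s14 - 5 * s05) / 2
  obtain rfl : 0 = a₅ := by linear_combination -s05
  refine ⟨?_, rfl⟩
  -- The multipliers evaluate the symbol of the terms with undifferentiated `u` at a zero of the
  -- quadratic factor, `ξ+η = 1` and `ξ²+η² = a₁`. There `h₁₀` and `h₁₁` drop out and `a₄(ξ+η)⁴ =
  -- a₄` remains.
  linear_combination ((2 * a₁ ^ 2 - (1 - a₁) ^ 2) * s04u0 + a₁ * (1 - a₁) * s13u0
    + (1 - a₁) ^ 2 * s22u0) / 4

/-- The determining equations with `a₆ = 1` for a symmetry in which `∂ₓ⁴ U` has coefficient `1`. -/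
theorem vector_order_two (hu : a₄ ≠ 0 ∨ a₅ ≠ 0) (hU : a₇ ≠ 0 ∨ a₈ ≠ 0 ∨ a₉ ≠ 0)
    (U4u1 : 4 * a₈ - 2 * k₂ = 0)
    (U3u2 : a₁ * k₂ + 4 * a₇ + 6 * a₈ - k₂ - 2 * k₄ = 0)
    (U2u3 : a₁ * k₄ + 6 * a₇ + 4 * a₈ - k₄ - 2 * k₉ = 0)
    (U1u4 : a₁ * k₉ + 4 * a₇ + a₈ - a₈ * h₁₅ - 2 * k₁₈ - k₉ = 0)
    (U3s01 : 8 * a₁₀ + a₅ * k₂ - 4 * k₅ = 0)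
    (U3u0u1 : a₂ * k₂ + 2 * a₈ * k₂ + 8 * a₉ - 4 * k₃ = 0)
    (U3s00u0 : a₄ * k₂ = 0)
    (U3u0u0u0 : a₃ * k₂ = 0)
    (U2s02 : 12 * a₁₀ + a₅ * k₄ - 2 * k₁₀ = 0)
    (U2s11 : 12 * a₁₀ + a₅ * k₄ - 2 * k₁₀ - 2 * k₅ = 0)
    (U1s03 : 8 * a₁₀ + a₅ * k₉ - a₈ * h₁₇ - 2 * k₂₀ = 0)
    (U1s12 : 24 * a₁₀ + 3 * a₅ * k₉ - a₈ * h₁₈ - 2 * k₁₀ - 2 * k₂₀ - 4 * k₂₁ = 0)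
    (U0s04 : a₅ * k₁₈ - a₇ * h₁₇ = 0)
    (U0s13 : 8 * a₁₀ + 4 * a₅ * k₁₈ - a₇ * h₁₇ - a₇ * h₁₈ - 2 * k₂₀ = 0)
    (U0s22 : 6 * a₁₀ + 3 * a₅ * k₁₈ - a₇ * h₁₈ - 2 * k₂₁ = 0)
    (U2s00u0u0 : 2 * a₄ * k₃ + 2 * a₉ * k₅ = 0)
    (U2u1u1 : a₂ * k₄ + 2 * a₈ * k₄ + 12 * a₉ - 2 * k₃ - 2 * k₇ = 0)
    (U2u0u2 : 2 * a₁ * k₃ + a₂ * k₄ + 3 * a₇ * k₂ + 3 * a₈ * k₂ + 12 * a₉ - a₈ * k₄ - 2 * k₃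
      - 2 * k₇ = 0)
    (s05 : a₅ * h₁₅ + h₁₇ - a₁ * h₁₇ - a₅ = 0)
    (s14 : 5 * a₅ * h₁₅ + h₁₈ - 2 * a₁ * h₁₇ - a₁ * h₁₈ - a₅ = 0)
    (s23 : 10 * a₅ * h₁₅ + h₁₇ + h₁₈ - a₁ * h₁₇ - 3 * a₁ * h₁₈ = 0)
    (s04u0 : 2 * a₄ * h₁₅ + a₅ * h₈ + a₈ * h₁₇ + h₁₀ - a₁ * h₁₀ - a₂ * h₁₇ - 2 * a₄ - a₅ * k₂ = 0)
    (s13u0 : 8 * a₄ * h₁₅ + 4 * a₅ * h₈ + a₈ * h₁₇ + a₈ * h₁₈ + 2 * h₁₁ - 2 * a₁ * h₁₀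
      - 2 * a₁ * h₁₁ - a₂ * h₁₇ - a₂ * h₁₈ - a₅ * k₂ = 0)
    (s22u0 : 6 * a₄ * h₁₅ + 3 * a₅ * h₈ + a₈ * h₁₈ + h₁₀ - a₁ * h₁₀ - 2 * a₁ * h₁₁ - a₂ * h₁₈ = 0)
    (s03u1 : 8 * a₄ * h₁₅ + a₅ * h₁₂ + 2 * a₇ * h₁₇ + 3 * a₈ * h₁₇ + h₁₃ - 2 * a₁ * h₁₀ - a₁ * h₁₃
      - a₂ * h₁₇ - a₅ * k₂ - a₅ * k₄ = 0)
    (s01u3 : 8 * a₄ * h₁₅ + a₅ * h₈ + 3 * a₇ * h₁₇ + a₇ * h₁₈ + a₈ * h₁₇ - 4 * a₁ * h₁₄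
      - 2 * a₅ * k₁₈ - a₅ * k₉ = 0)
    (s02u2 : 12 * a₄ * h₁₅ + a₅ * h₁₂ + 3 * a₇ * h₁₇ + a₇ * h₁₈ + 3 * a₈ * h₁₇ + 2 * h₁₄
      - 2 * a₁ * h₁₃ - 2 * a₁ * h₁₄ - a₅ * k₄ - a₅ * k₉ = 0)
    (s11u2 : 12 * a₄ * h₁₅ + a₅ * h₁₂ + 2 * a₇ * h₁₈ + a₈ * h₁₈ - 2 * a₁ * h₁₃ - 2 * a₁ * h₁₄
      - a₅ * k₉ = 0)
    (u1u4 : 4 * a₂ * h₁₅ - 2 * a₁ * h₈ = 0)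
    (U1u0u3 : a₁ * k₇ + a₂ * k₉ + 3 * a₇ * k₂ + a₈ * k₂ + 8 * a₉ - a₈ * h₈ - a₈ * k₉ - 2 * k₁₄
      - k₇ = 0)
    (U0u0u4 : a₁ * k₁₄ + a₂ * k₁₈ + a₇ * k₂ + 2 * a₉ - a₇ * h₈ - a₈ * k₁₈ - 2 * a₉ * h₁₅ - k₁₄ = 0)
    (U0u1u3 : 2 * a₁ * k₁₆ + 4 * a₂ * k₁₈ + a₇ * k₄ + 8 * a₉ - a₇ * h₁₂ - a₇ * h₈ - 2 * k₁₄
      - 2 * k₁₆ = 0)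
    (U0u2u2 : a₁ * k₁₄ + 3 * a₂ * k₁₈ + a₇ * k₉ + 6 * a₉ - a₇ * h₁₂ - k₁₄ - 2 * k₁₆ = 0)
    (s00s03 : 4 * a₁₀ * h₁₇ + a₅ * h₁₄ + h₁₆ - a₁ * h₁₆ - a₄ * h₁₇ - a₅ * k₂₀ - a₅ * k₅ = 0) :
    a₃ = 0 ∧ a₄ = 0 ∧ a₅ ≠ 0 ∧ a₈ ≠ 0 ∧ a₂ = 2 * a₁ * a₈ ∧ a₇ = (1 - a₁) * a₈ / 2 ∧
      a₉ = (1 - 2 * a₁) * a₈ ^ 2 / 4 ∧ a₁₀ = -a₅ * a₈ / 4 := by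
  obtain rfl : 2 * a₈ = k₂ := by linear_combination U4u1 / 2
  obtain rfl : (a₁ + 2) * a₈ + 2 * a₇ = k₄ := by linear_combination U3u2 / 2
  obtain rfl : 0 = k₅ := by linear_combination (U2s11 - U2s02) / 2
  obtain rfl : -a₅ * a₈ / 4 = a₁₀ := by linear_combination -U3s01 / 8
  obtain rfl : (a₂ + 2 * a₈) * a₈ / 2 + 2 * a₉ = k₃ := by linear_combination U3u0u1 / 4
  obtain rfl : a₅ * ((a₁ - 1) * a₈ / 2 + a₇) = k₁₀ := by linear_combination U2s02 / 2
  obtain rfl : ((a₁ - 1) * ((a₁ + 2) * a₈ + 2 * a₇) + 6 * a₇ + 4 * a₈) / 2 = k₉ := by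
    linear_combination U2u3 / 2
  have hk₂₁ : k₂₁ = k₂₀ + a₅ * a₈ / 4 := by linear_combination (U0s13 - U0s04 - U0s22) / 2
  -- Since `k₂ = 2a₈`, the equations `a₄k₂ = 0` and `a₃k₂ = 0` settle `a₃` and `a₄` once `a₈ ≠ 0`.
  -- The case `a₈ = 0` is contradictory; it splits according to which of `a₇`, `a₉` keeps `u` in the
  -- equation for `U`.
  by_cases h₀ : a₈ = 0
  · exfalso
    obtain rfl := h₀.symm
    obtain rfl : a₅ * ((a₁ + 2) * a₇) / 2 = k₂₀ := by linear_combination U1s03 / 2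
    subst hk₂₁
    have hprod : a₅ * a₇ = 0 := by linear_combination -U1s12 / 2
    by_cases h₇ : a₇ = 0
    · obtain rfl := h₇.symm
      have ha₉ : a₉ ≠ 0 := by simpa using hU
      obtain rfl : 0 = a₄ := (mul_left_cancel₀ ha₉ (by linear_combination U2s00u0u0 / 4)).symm
      obtain rfl : 0 = a₁ :=
        (mul_left_cancel₀ ha₉ (by linear_combination (U2u0u2 - U2u1u1) / 4)).symm
      have ha₅ : a₅ ≠ 0 := by simpa using hu
      obtain rfl : -1 / 2 = h₁₅ := by
        refine mul_left_cancel₀ ha₅ ?_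
        linear_combination (s05 + s14 - s23) / 4
      obtain rfl : 0 = k₁₈ := (mul_left_cancel₀ ha₅ (by linear_combination U0s04)).symm
      obtain rfl : 0 = a₂ := by linear_combination u1u4 / 2
      obtain rfl : 3 * a₉ = k₁₄ := by linear_combination U0u0u4
      obtain rfl : a₉ = k₁₆ := by linear_combination U0u1u3 / 2
      exact ha₉ (by linear_combination U0u2u2)
    · obtain rfl : 0 = a₅ := by simpa [h₇, eq_comm] using hprod
      have ha₄ : a₄ ≠ 0 := by simpa using hu
      obtain rfl : 0 = h₁₇ := (mul_left_cancel₀ h₇ (by linear_combination -U0s04)).symm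
      obtain rfl : 0 = h₁₈ := (mul_left_cancel₀ h₇ (by linear_combination -U0s22)).symm
      obtain rfl : 0 = h₁₄ := by linear_combination (s11u2 - s02u2) / 2
      obtain rfl : 0 = h₁₅ := (mul_left_cancel₀ ha₄ (by linear_combination s01u3 / 8)).symm
      have hz : (1 - a₁) * a₄ = 0 := by
        linear_combination (a₁ * s13u0 - a₁ * s03u1 - (1 - a₁) * (s04u0 - s22u0)) / 2
          - (1 - a₁) / 4 * s02u2
      refine ha₄ ((pow_eq_zero_iff two_ne_zero).1 ?_)
      linear_combination (h₁₀ * hz - a₄ * s04u0) / 2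
  · obtain rfl : 0 = a₄ := (mul_right_cancel₀ h₀ (by linear_combination U3s00u0 / 2)).symm
    obtain rfl : 0 = a₃ := (mul_right_cancel₀ h₀ (by linear_combination U3u0u0u0 / 2)).symm
    have ha₅ : a₅ ≠ 0 := by simpa using hu
    obtain rfl : 3 * h₁₇ - a₅ = h₁₈ := by linear_combination (5 * s05 - 3 * s14 + s23) / 2
    obtain rfl : (3 + a₁) * a₅ / 2 = h₁₇ := by linear_combination (s14 - 5 * s05) / 2
    obtain rfl : (1 - a₁) * a₈ / 2 = a₇ := by
      refine mul_left_cancel₀ ha₅ ?_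
      linear_combination (U1s12 - 3 * U1s03 + 4 * hk₂₁) / 2
    -- This is the value of `ξ⁴+η⁴` at `ξ+η = 1`, `ξ²+η² = a₁`, where the quadratic symbol vanishes.
    obtain rfl : (a₁ ^ 2 + 2 * a₁ - 1) / 2 = h₁₅ := by
      refine mul_left_cancel₀ ha₅ ?_
      linear_combination -s05
    obtain rfl : -a₅ * a₈ * (3 + a₁) / 4 = k₂₀ := by linear_combination U1s03 / 2
    obtain rfl : a₈ * (1 - a₁) * (3 + a₁) / 4 = k₁₈ := by linear_combination U1u4 / 2
    obtain rfl : (1 + a₁) * a₂ + (2 * a₁ - 2) * a₈ = h₈ := by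
      refine mul_left_cancel₀ ha₅ ?_
      -- The same evaluation as in `decoupled` again eliminates `h₁₀` and `h₁₁`.
      linear_combination -((2 * a₁ ^ 2 - (1 - a₁) ^ 2) * s04u0 + a₁ * (1 - a₁) * s13u0
        + (1 - a₁) ^ 2 * s22u0) / 2
    obtain rfl : 2 * a₁ * a₈ = a₂ := by
      -- `u1u4` now reads `2(a₁ - 1)(a₂ - 2a₁a₈) = 0`, which is void for `a₁ = 1`; there the quartic
      -- equation `s00s03` takes over.
      by_cases h₁ : a₁ = 1
      · obtain rfl := h₁.symm
        obtain rfl : a₅ * a₂ / 2 = h₁₄ := by linear_combination s01u3 / 4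
        refine mul_left_cancel₀ (pow_ne_zero 2 ha₅) ?_
        linear_combination -2 * s00s03
      · refine mul_left_cancel₀ (sub_ne_zero.2 h₁) ?_
        linear_combination -u1u4 / 2
    refine ⟨rfl, rfl, ha₅, h₀, rfl, rfl, ?_, rfl⟩
    -- The difference of `U2u0u2` and `U2u1u1` determines `a₉` only up to the factor `a₁`.
    by_cases h₁ : a₁ = 0
    · obtain rfl := h₁.symm
      linear_combination U0u0u4 - U1u0u3 / 2 + U2u1u1 / 4
    · refine mul_left_cancel₀ h₁ ?_
      linear_combination (U2u0u2 - U2u1u1) / 4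

end Determining

namespace Reflection

/-! ### Homogeneous polynomials -/

def ScalarGen.code : ScalarGen → ℕ × ℕ × ℕ
  | .u k => (0, k, 0)
  | .s m d => (1, m, d)

theorem ScalarGen.code_injective : Function.Injective ScalarGen.code := by
  intro g g' h
  cases g <;> cases g' <;> simp_all [ScalarGen.code]

instance : DecidableEq ScalarGen := ScalarGen.code_injective.decidableEq

/-- The monomials of weight `n ≤ 5`. -/
def terms (n : ℕ) : List (List ScalarGen) :=
  if n = 5 then scalarTerms
  -- In weight 5 the factor `M` of `M ∂ₓᵏ U` has weight `4 - k`, so `vectorTerms` already contains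
  -- the monomials of each lower weight.
  else (vectorTerms.filter fun t => t.1 + n == 4).map Prod.snd

/-- The generators of weight at most `5`. -/
def generators : List ScalarGen :=
  [.u 0, .u 1, .u 2, .u 3, .u 4, .s 0 0, .s 0 1, .s 0 2, .s 0 3, .s 1 0, .s 1 1]

theorem mem_generators {g : ScalarGen} (hg : g.weight ≤ 5) : g ∈ generators := by
  rcases g with k | ⟨m, d⟩ <;> simp only [ScalarGen.weight] at hg
  · have : k ≤ 4 := by omega
    interval_cases k <;> simp [generators]
  · have : m ≤ 1 := by omega
    have : d ≤ 3 := by omega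
    interval_cases m <;> interval_cases d <;> first | omega | simp [generators]

/-- Closure of the lists under multiplication by a generator is the induction step for their
completeness in `exists_terms`. -/
theorem cons_mem_terms : ∀ n ≤ 5, ∀ g ∈ generators, g.weight ≤ n → ∀ l ∈ terms (n - g.weight),
    ∃ l' ∈ terms n, l'.isPerm (g :: l) = true := by
  decide +kernel

theorem exists_terms (n : ℕ) (hn : n ≤ 5) (d : ScalarGen →₀ ℕ)
    (hd : Finsupp.weight ScalarGen.weight d = n) : ∃ l ∈ terms n, exponent l = d := by
  induction n using Nat.strong_induction_on generalizing d with
  | _ n ih =>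
    by_cases h : d = 0
    · subst h
      obtain rfl : 0 = n := by simpa using hd
      exact ⟨[], by decide +kernel, rfl⟩
    · obtain ⟨g, hg⟩ := Finsupp.ne_iff.1 h
      obtain ⟨d, rfl⟩ : ∃ e, d = Finsupp.single g 1 + e :=
        ⟨d - Finsupp.single g 1, (add_tsub_cancel_of_le
          (Finsupp.single_le_iff.2 (Nat.one_le_iff_ne_zero.2 hg))).symm⟩
      rw [map_add, Finsupp.weight_single, one_smul] at hd
      have hpos : 0 < g.weight := by cases g <;> simp [ScalarGen.weight]
      obtain ⟨l, hl, rfl⟩ := ih (n - g.weight) (by omega) (by omega) d (by omega)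
      obtain ⟨l', hl', hp⟩ := cons_mem_terms n hn g (mem_generators (by omega)) (by omega) l hl
      refine ⟨l', hl', ?_⟩
      rw [exponent_inj.2 (List.isPerm_iff.1 hp)]
      simp [exponent]

theorem terms_pairwise : ∀ n ≤ 5, (terms n).Pairwise fun l l' => l.isPerm l' = false := by
  decide +kernel

/-- Turns an arbitrary homogeneous right-hand side into an ansatz with finitely many coefficients.
Completeness of the list gives every monomial, and `terms_pairwise` prevents double counting. -/
theorem eq_sum_terms (n : ℕ) (hn : n ≤ 5) (p : ScalarPoly)
    (hp : ∀ d, coeff d p ≠ 0 → Finsupp.weight ScalarGen.weight d = n) :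
    p = ((terms n).map fun l => C (coeff (exponent l) p) * (l.map X).prod).sum := by
  classical
  have hnodup : ((terms n).map exponent).Nodup := by
    rw [List.Nodup, List.pairwise_map]
    refine (terms_pairwise n hn).imp fun {l l'} h he => ?_
    rw [List.isPerm_iff.2 (exponent_inj.1 he)] at h
    exact absurd h (by simp)
  calc p = ∑ d ∈ ((terms n).map exponent).toFinset, monomial d (coeff d p) := by
        conv_lhs => rw [p.as_sum]
        refine Finset.sum_subset (fun d hd => ?_) fun d _ hd => ?_
        · obtain ⟨l, hl, rfl⟩ := exists_terms n hn d (hp d (mem_support_iff.1 hd))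
          exact List.mem_toFinset.2 (List.mem_map_of_mem hl)
        · rw [notMem_support_iff.1 hd, monomial_zero]
    _ = _ := by
        rw [List.sum_toFinset _ hnodup, List.map_map]
        congr 1
        refine List.map_congr_left fun l _ => ?_
        rw [prod_X, C_mul_monomial, mul_one, Function.comp_apply]

/-! ### The parameters of a symmetry -/

/-- The coefficients of a second order system, of `u_τ` and of `U_τ`, in this order. -/
def parameter (a : List ℂ) (T : EvolutionSystem) (v : ℕ) : ℂ :=
  -- Disjoint blocks: `1–10` for `a₁, …, a₁₀`, `33–50` for `h₁, …, h₁₈`, `65–85` for `k₁, …, k₂₁`.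
  -- In particular `47` is `h₁₅` and `65` is `k₁`.
  if v < 33 then a.getD (v - 1) 0
  else if v < 65 then coeff (exponent (scalarTerms.getD (v - 33) [])) T.scalar
  else coeff (exponent (vectorTerms.getD (v - 65) (0, [])).2)
    (T.vector (vectorTerms.getD (v - 65) (0, [])).1)

theorem den_symmetryScalar (a : List ℂ) {T : EvolutionSystem} (hT : T.IsHomogeneous 4) :
    den (parameter a T) symmetryScalar = T.scalarRHS 2 := by
  rw [symmetryScalar, den_combination _ (fun l => coeff (exponent l) T.scalar) _ _ _ fun j hj => ?_,
    EvolutionSystem.scalarRHS]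
  · conv_rhs => rw [eq_sum_terms 5 le_rfl T.scalar hT.1]
    rw [map_list_sum, List.map_map, terms, if_pos rfl]
    congr 1
    refine List.map_congr_left fun l _ => ?_
    rw [den_prodPol, Function.comp_apply, map_mul]
    simp [ScalarPoly.toDiffPoly]
  · have : j < 18 := hj
    rw [parameter, if_neg (by omega), if_pos (by omega), Nat.add_sub_cancel_left,
      List.getD_eq_getElem _ _ hj]

theorem den_vectorTerm (γ : ℕ → ℂ) (e : Fin 2) (t : ℕ × List ScalarGen) :
    den γ (vectorTerm e t) = X (.U e t.1) * ScalarPoly.toDiffPoly 2 (t.2.map X).prod := by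
  have : jet (3 * t.1 + e + 1) = .U e t.1 := by
    fin_cases e
    · rw [jet, if_neg (by simp), if_pos (by simp)]
      congr 1
      simp; omega
    · rw [jet, if_neg (by simp; omega), if_neg (by simp; omega)]
      congr 1
      simp; omega
  rw [vectorTerm, den_map_mulTerm, den_prodPol]
  simp [Term.den, this]

theorem den_symmetryVector (a : List ℂ) {T : EvolutionSystem} (hT : T.IsHomogeneous 4)
    (e : Fin 2) : den (parameter a T) (symmetryVector e) = T.vectorRHS 2 e := by
  rw [symmetryVector, den_combination _ (fun t => coeff (exponent t.2) (T.vector t.1)) _ _ _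
    fun j hj => ?_, EvolutionSystem.vectorRHS]
  · have hsupp : T.vector.support ⊆ Finset.range 5 := by
      intro k hk
      obtain ⟨d, hd⟩ := ne_zero_iff.1 (Finsupp.mem_support_iff.1 hk)
      have := hT.2 k d hd
      exact Finset.mem_range.2 (by omega)
    have hvec (k : ℕ) (hk : k ≤ 4) : T.vector k =
        ((terms (4 - k)).map fun l => C (coeff (exponent l) (T.vector k)) * (l.map X).prod).sum :=
      eq_sum_terms (4 - k) (by omega) _ fun d hd => by have := hT.2 k d hd; omega
    -- Making the coefficients opaque keeps the expansions of `T.vector k` from rewriting the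
    -- coefficients they contain.
    obtain ⟨c, hc⟩ : ∃ c : ℕ → List ScalarGen → ℂ, ∀ k l, coeff (exponent l) (T.vector k) = c k l :=
      ⟨_, fun _ _ => rfl⟩
    simp only [hc] at hvec ⊢
    rw [Finsupp.sum_of_support_subset _ hsupp _ (by simp)]
    simp only [Finset.sum_range_succ, Finset.range_zero, Finset.sum_empty, den_vectorTerm]
    rw [hvec 0 (by omega), hvec 1 (by omega), hvec 2 (by omega), hvec 3 (by omega),
      hvec 4 (by omega)]
    simp [vectorTerms, terms, ScalarPoly.toDiffPoly]
    ring
  · have : j < 21 := hj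
    rw [parameter, if_neg (by omega), if_neg (by omega), Nat.add_sub_cancel_left,
      List.getD_eq_getElem _ _ hj]

theorem den_systemScalar (a₁ a₂ a₃ a₄ a₅ a₆ a₇ a₈ a₉ a₁₀ : ℂ) (T : EvolutionSystem) :
    den (parameter [a₁, a₂, a₃, a₄, a₅, a₆, a₇, a₈, a₉, a₁₀] T) systemScalar =
      (secondOrderSystem a₁ a₂ a₃ a₄ a₅ a₆ a₇ a₈ a₉ a₁₀).scalarRHS 2 := by
  simp [systemScalar, combination, den_map_mulTerm, den_prodPol, Term.den, parameter,
    EvolutionSystem.scalarRHS, secondOrderSystem, ScalarPoly.toDiffPoly]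
  ring

theorem den_systemVector (a₁ a₂ a₃ a₄ a₅ a₆ a₇ a₈ a₉ a₁₀ : ℂ) (T : EvolutionSystem) (e : Fin 2) :
    den (parameter [a₁, a₂, a₃, a₄, a₅, a₆, a₇, a₈, a₉, a₁₀] T) (systemVector e) =
      (secondOrderSystem a₁ a₂ a₃ a₄ a₅ a₆ a₇ a₈ a₉ a₁₀).vectorRHS 2 e := by
  rw [EvolutionSystem.vectorRHS, secondOrderSystem, Finsupp.sum_add_index' (by simp)
    (by simp [add_mul]), Finsupp.sum_add_index' (by simp) (by simp [add_mul]),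
    Finsupp.sum_single_index (by simp), Finsupp.sum_single_index (by simp),
    Finsupp.sum_single_index (by simp)]
  simp [systemVector, combination, den_map_mulTerm, den_vectorTerm, Term.den, parameter,
    ScalarPoly.toDiffPoly]
  ring

/-- The equations in the tables, for coefficients `x` of the system and `y` of the symmetry. -/
def Determined (x y : ℕ → ℂ) : Prop :=
  ∀ r ∈ scalarTable ++ vectorTable, (r.2.map fun r => (r.1 : ℂ) * x r.2.1 * y r.2.2).sum = 0

/-- Each term has one factor from the system and one from the symmetry, so a leading coefficient on
either side can be normalized to `1`. -/
theorem Determined.div {x y : ℕ → ℂ} (h : Determined x y) (α β : ℂ) :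
    Determined (fun i => x i / α) fun j => y j / β := by
  intro r hr
  have h' := congrArg (· * (α⁻¹ * β⁻¹)) (h r hr)
  simp only [← List.sum_map_mul_right, zero_mul] at h'
  rw [← h']
  congr 1
  refine List.map_congr_left fun r _ => ?_
  ring

theorem determined_of_flowsCommute {a₁ a₂ a₃ a₄ a₅ a₆ a₇ a₈ a₉ a₁₀ : ℂ} {T : EvolutionSystem}
    (hT : T.IsHomogeneous 4)
    (hc : (secondOrderSystem a₁ a₂ a₃ a₄ a₅ a₆ a₇ a₈ a₉ a₁₀).FlowsCommute T) :
    Determined (parameter [a₁, a₂, a₃, a₄, a₅, a₆, a₇, a₈, a₉, a₁₀] T)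
      (parameter [a₁, a₂, a₃, a₄, a₅, a₆, a₇, a₈, a₉, a₁₀] T) := by
  set S := secondOrderSystem a₁ a₂ a₃ a₄ a₅ a₆ a₇ a₈ a₉ a₁₀ with hS
  set γ := parameter [a₁, a₂, a₃, a₄, a₅, a₆, a₇, a₈, a₉, a₁₀] T with hγ
  have s : den γ systemScalar = S.scalarRHS 2 := den_systemScalar ..
  have v₀ : den γ (systemVector 0) = S.vectorRHS 2 0 := den_systemVector (e := 0) ..
  have v₁ : den γ (systemVector 1) = S.vectorRHS 2 1 := den_systemVector (e := 1) ..
  have s' : den γ symmetryScalar = T.scalarRHS 2 := den_symmetryScalar _ hT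
  have v₀' : den γ (symmetryVector 0) = T.vectorRHS 2 0 := den_symmetryVector _ hT 0
  have v₁' : den γ (symmetryVector 1) = T.vectorRHS 2 1 := den_symmetryVector _ hT 1
  have hcomm (p q : Pol) (h : S.timeDeriv 2 (den γ q) = T.timeDeriv 2 (den γ p)) :
      den γ (commutator p q) = 0 := by
    rw [commutator, den_append, den_map_mulTerm, ← timeDeriv_den γ S s v₀ v₁,
      ← timeDeriv_den γ T s' v₀' v₁', h]
    simp [Term.den]
  intro r hr
  rcases List.mem_append.1 hr with hr | hr
  · refine sum_eq_zero_of_hasCoefficient γ (hcomm systemScalar symmetryScalar ?_)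
      (List.all_eq_true.1 scalarTable_correct r hr)
    rw [s, s']
    exact (hc 2 (by norm_num)).1
  · refine sum_eq_zero_of_hasCoefficient γ (hcomm (systemVector 0) (symmetryVector 0) ?_)
      (List.all_eq_true.1 vectorTable_correct r hr)
    rw [v₀, v₀']
    exact (hc 2 (by norm_num)).2 0

/-! ### The tabulated equations in each case -/

variable {x y : ℕ → ℂ}

/-- The case `a₁ = 1`, `a₆ = 0`: no term `∂ₓ⁴ U`. -/
theorem Determined.fourth_vanishes (E : Determined x y)
    (hu : x 4 ≠ 0 ∨ x 5 ≠ 0) (hU : x 7 ≠ 0 ∨ x 8 ≠ 0 ∨ x 9 ≠ 0)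
    (h₁ : x 1 = 1) (h₆ : x 6 = 0) :
    y 65 = 0 := by
  simp only [Determined, scalarTable, vectorTable, List.cons_append, List.nil_append,
    List.forall_mem_cons, List.not_mem_nil, List.map_cons, List.map_nil, List.sum_cons, List.sum_nil,
    Int.cast_neg, Int.cast_ofNat, Int.cast_one, h₁, h₆] at E
  -- The conjuncts come in the order of `scalarTable` followed by `vectorTable`; a dash drops a row.
  obtain ⟨s05, s14, s23, -, -, -, -, -, -, -, -, -, -, -, -, -, -, -, -, -, -, -, -, -, -, -, -,
    U4u1, U3u2, -, -, -, -, -, -, -, -, -, -, -, U3s00u0, U3u0u1, -, -, -, -, -, -, -, -, -, -, -,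
    -, -, -, -, -, -, -⟩ := E
  exact Determining.fourth_vanishes
    (a₂ := x 2) (a₄ := x 4) (a₅ := x 5) (a₇ := x 7) (a₈ := x 8) (a₉ := x 9) (h₁₅ := y 47)
    (h₁₇ := y 49) (h₁₈ := y 50) (k₁ := y 65) (k₂ := y 66) hu hU
    (by linear_combination s05) (by linear_combination s14) (by linear_combination s23)
    (by linear_combination U4u1) (by linear_combination U3u2) (by linear_combination U3s00u0)
    (by linear_combination U3u0u1)

/-- The case `a₁ = 1`, `a₆ = 0`. -/
theorem Determined.scalar_order_two (E : Determined x y)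
    (hu : x 4 ≠ 0 ∨ x 5 ≠ 0) (hU : x 7 ≠ 0 ∨ x 8 ≠ 0 ∨ x 9 ≠ 0)
    (h₁ : x 1 = 1) (h₆ : x 6 = 0) (hh : y 47 = 1) (hk : y 65 = 0) :
    x 3 = 0 ∧ x 4 = 0 ∧ x 5 ≠ 0 ∧
      (x 8 ≠ 0 ∧ x 2 = 2 * x 8 ∧ x 7 = x 8 / 2 ∧ x 9 = 0 ∧ x 10 = 0 ∨
        x 7 ≠ 0 ∧ x 8 = 0 ∧ x 2 = -4 * x 7 ∧ x 9 = -2 * x 7 ^ 2 ∧ x 10 = x 5 * x 7 / 2) := by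
  simp only [Determined, scalarTable, vectorTable, List.cons_append, List.nil_append,
    List.forall_mem_cons, List.not_mem_nil, List.map_cons, List.map_nil, List.sum_cons, List.sum_nil,
    Int.cast_neg, Int.cast_ofNat, Int.cast_one, h₁, h₆, hh, hk] at E
  obtain ⟨s05, s14, -, u1u4, u2u3, s04u0, s13u0, s03u1, s02u2, s00s03, s00s12, s01s02, -, -, -,
    u0u1u3, u0u2u2, s00u0u3, s03u0u0, s02u0u1, s01u0u2, s00u1u2, s00s00u2, s00s01u1, s00s02u0,
    u0u0u0u3, u0u0u0u0u2, -, U3u2, U2u3, U1u4, U0u5, -, -, -, -, -, -, -, -, -, -, U2u0u2, U0u0u4,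
    U0u1u3, U0u2u2, U1u0u3, U1u1u2, U0s00s02, U2s00u1, U0s02u1, U0s01u2, U1s01u1, U1s00u2,
    U0s00u3, -, U0s00u1u1, -, -, -⟩ := E
  exact Determining.scalar_order_two
    (a₂ := x 2) (a₃ := x 3) (a₄ := x 4) (a₅ := x 5) (a₇ := x 7) (a₈ := x 8) (a₉ := x 9)
    (a₁₀ := x 10) (h₄ := y 36) (h₅ := y 37) (h₆ := y 38) (h₇ := y 39) (h₈ := y 40) (h₉ := y 41)
    (h₁₀ := y 42) (h₁₁ := y 43) (h₁₂ := y 44) (h₁₃ := y 45) (h₁₄ := y 46) (h₁₆ := y 48)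
    (h₁₇ := y 49) (h₁₈ := y 50) (k₂ := y 66) (k₃ := y 67) (k₄ := y 68) (k₅ := y 69) (k₇ := y 71)
    (k₈ := y 72) (k₉ := y 73) (k₁₀ := y 74) (k₁₄ := y 78) (k₁₅ := y 79) (k₁₆ := y 80)
    (k₁₇ := y 81) (k₁₈ := y 82) (k₂₀ := y 84) (k₂₁ := y 85) hU
    (by linear_combination U3u2) (by linear_combination U2u3) (by linear_combination U1u4)
    (by linear_combination U0u5) (by linear_combination U2u0u2) (by linear_combination u1u4)
    (by linear_combination u2u3) (by linear_combination u0u1u3) (by linear_combination u0u2u2)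
    (by linear_combination u0u0u0u3) (by linear_combination u0u0u0u0u2)
    (by linear_combination s05) (by linear_combination s14) (by linear_combination s04u0)
    (by linear_combination s13u0) (by linear_combination s03u1) (by linear_combination s02u2)
    (by linear_combination U0u0u4) (by linear_combination U0u1u3) (by linear_combination U0u2u2)
    (by linear_combination U1u0u3) (by linear_combination U1u1u2) (by linear_combination s00u0u3)
    (by linear_combination s03u0u0) (by linear_combination s02u0u1)
    (by linear_combination s01u0u2) (by linear_combination s00u1u2) (by linear_combination s00s03)
    (by linear_combination s00s12) (by linear_combination s01s02) (by linear_combination s00s00u2)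
    (by linear_combination s00s01u1) (by linear_combination s00s02u0)
    (by linear_combination U0s00s02) (by linear_combination U2s00u1)
    (by linear_combination U0s02u1) (by linear_combination U0s01u2)
    (by linear_combination U1s01u1) (by linear_combination U1s00u2)
    (by linear_combination U0s00u3) (by linear_combination U0s00u1u1) hu

/-- The case `a₆ = 1` without a term `∂ₓ⁴ U`. -/
theorem Determined.decoupled (E : Determined x y)
    (h₆ : x 6 = 1) (hh : y 47 = 1) (hk : y 65 = 0) :
    x 4 = 0 ∧ x 5 = 0 := by
  simp only [Determined, scalarTable, vectorTable, List.cons_append, List.nil_append,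
    List.forall_mem_cons, List.not_mem_nil, List.map_cons, List.map_nil, List.sum_cons, List.sum_nil,
    Int.cast_neg, Int.cast_ofNat, Int.cast_one, h₆, hh, hk] at E
  obtain ⟨s05, s14, s23, -, -, s04u0, s13u0, -, -, -, -, -, s22u0, -, -, -, -, -, -, -, -, -, -,
    -, -, -, -, -, -, -, -, -, -, -, -, -, -, -, -, -, -, -, -, -, -, -, -, -, -, -, -, -, -, -,
    -, -, -, -, -, -⟩ := E
  exact Determining.decoupled
    (a₁ := x 1) (a₂ := x 2) (a₄ := x 4) (a₅ := x 5) (a₈ := x 8) (h₈ := y 40) (h₁₀ := y 42)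
    (h₁₁ := y 43) (h₁₇ := y 49) (h₁₈ := y 50) (k₂ := y 66) 
    (by linear_combination s05) (by linear_combination s14) (by linear_combination s23)
    (by linear_combination s04u0) (by linear_combination s13u0) (by linear_combination s22u0)

/-- The case `a₆ = 1` with a term `∂ₓ⁴ U`. -/
theorem Determined.vector_order_two (E : Determined x y)
    (hu : x 4 ≠ 0 ∨ x 5 ≠ 0) (hU : x 7 ≠ 0 ∨ x 8 ≠ 0 ∨ x 9 ≠ 0)
    (h₆ : x 6 = 1) (hk : y 65 = 1) :
    x 3 = 0 ∧ x 4 = 0 ∧ x 5 ≠ 0 ∧ x 8 ≠ 0 ∧ x 2 = 2 * x 1 * x 8 ∧ x 7 = (1 - x 1) * x 8 / 2 ∧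
      x 9 = (1 - 2 * x 1) * x 8 ^ 2 / 4 ∧ x 10 = -x 5 * x 8 / 4 := by
  simp only [Determined, scalarTable, vectorTable, List.cons_append, List.nil_append,
    List.forall_mem_cons, List.not_mem_nil, List.map_cons, List.map_nil, List.sum_cons, List.sum_nil,
    Int.cast_neg, Int.cast_ofNat, Int.cast_one, h₆, hk] at E
  obtain ⟨s05, s14, s23, u1u4, -, s04u0, s13u0, s03u1, s02u2, s00s03, -, -, s22u0, s01u3, s11u2,
    -, -, -, -, -, -, -, -, -, -, -, -, U4u1, U3u2, U2u3, U1u4, -, U3s01, U2s02, U2s11, U1s03,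
    U1s12, U0s04, U0s13, U0s22, U3s00u0, U3u0u1, U2u0u2, U0u0u4, U0u1u3, U0u2u2, U1u0u3, -, -, -,
    -, -, -, -, -, U2u1u1, -, U3u0u0u0, U2s00u0u0, -⟩ := E
  exact Determining.vector_order_two
    (a₁ := x 1) (a₂ := x 2) (a₃ := x 3) (a₄ := x 4) (a₅ := x 5) (a₇ := x 7) (a₈ := x 8)
    (a₉ := x 9) (a₁₀ := x 10) (h₈ := y 40) (h₁₀ := y 42) (h₁₁ := y 43) (h₁₂ := y 44)
    (h₁₃ := y 45) (h₁₄ := y 46) (h₁₅ := y 47) (h₁₆ := y 48) (h₁₇ := y 49) (h₁₈ := y 50)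
    (k₂ := y 66) (k₃ := y 67) (k₄ := y 68) (k₅ := y 69) (k₇ := y 71) (k₉ := y 73) (k₁₀ := y 74)
    (k₁₄ := y 78) (k₁₆ := y 80) (k₁₈ := y 82) (k₂₀ := y 84) (k₂₁ := y 85) hu hU
    (by linear_combination U4u1) (by linear_combination U3u2) (by linear_combination U2u3)
    (by linear_combination U1u4) (by linear_combination U3s01) (by linear_combination U3u0u1)
    (by linear_combination U3s00u0) (by linear_combination U3u0u0u0) (by linear_combination U2s02)
    (by linear_combination U2s11) (by linear_combination U1s03) (by linear_combination U1s12)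
    (by linear_combination U0s04) (by linear_combination U0s13) (by linear_combination U0s22)
    (by linear_combination U2s00u0u0) (by linear_combination U2u1u1)
    (by linear_combination U2u0u2) (by linear_combination s05) (by linear_combination s14)
    (by linear_combination s23) (by linear_combination s04u0) (by linear_combination s13u0)
    (by linear_combination s22u0) (by linear_combination s03u1) (by linear_combination s01u3)
    (by linear_combination s02u2) (by linear_combination s11u2) (by linear_combination u1u4)
    (by linear_combination U1u0u3) (by linear_combination U0u0u4) (by linear_combination U0u1u3)
    (by linear_combination U0u2u2) (by linear_combination s00s03)

end Reflection

/-! ### Scalings -/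

/-- By homogeneity, scaling `x` amounts to scaling `t, u, U`, so `ξ = 1` suffices. The `aᵢ` are the
old coefficients and the `bᵢ` the new ones. -/
theorem coincideUpToScaling_of {a₁ a₂ a₃ a₄ a₅ a₆ a₇ a₈ a₉ a₁₀ : ℂ}
    {b₁ b₂ b₃ b₄ b₅ b₆ b₇ b₈ b₉ b₁₀ τ μ ν : ℂ}
    (hτ : τ ≠ 0) (hμ : μ ≠ 0) (hν : ν ≠ 0)
    (h₁ : τ * b₁ = a₁) (h₂ : τ * b₂ = μ * a₂) (h₃ : τ * b₃ = μ ^ 2 * a₃)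
    (h₄ : τ * b₄ = ν ^ 2 * a₄) (h₅ : μ * τ * b₅ = ν ^ 2 * a₅) (h₆ : τ * b₆ = a₆)
    (h₇ : τ * b₇ = μ * a₇) (h₈ : τ * b₈ = μ * a₈) (h₉ : τ * b₉ = μ ^ 2 * a₉)
    (h₁₀ : τ * b₁₀ = ν ^ 2 * a₁₀) :
    (secondOrderSystem a₁ a₂ a₃ a₄ a₅ a₆ a₇ a₈ a₉ a₁₀).CoincideUpToScaling
      (secondOrderSystem b₁ b₂ b₃ b₄ b₅ b₆ b₇ b₈ b₉ b₁₀) := by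
  have lift {p q : ℂ} (h : p = q) : (C p : ScalarPoly) = C q := congrArg C h
  refine ⟨τ, 1, μ, ν, hτ, one_ne_zero, hμ, hν, ?_, fun k => ?_⟩
  · have e₁ := lift h₁
    have e₂ := lift h₂
    have e₃ := lift h₃
    have e₄ := lift h₄
    have e₅ := lift h₅
    simp only [C_mul, C_pow] at e₁ e₂ e₃ e₄ e₅
    simp only [secondOrderSystem, rescale, map_add, map_mul, map_pow, aeval_X, algHom_C,
      algebraMap_eq, one_pow, mul_one]
    linear_combination C μ * X (.u 2) * e₁ + C μ * (X (.u 0) * X (.u 1)) * e₂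
      + C μ * X (.u 0) ^ 3 * e₃ + C μ * (X (.u 0) * X (.s 0 0)) * e₄ + X (.s 0 1) * e₅
  · have e₆ := lift h₆
    have e₇ := lift h₇
    have e₈ := lift h₈
    have e₉ := lift h₉
    have e₁₀ := lift h₁₀
    simp only [C_mul, C_pow] at e₆ e₇ e₈ e₉ e₁₀
    simp only [secondOrderSystem, Finsupp.add_apply, one_pow, mul_one]
    match k with
    | 0 =>
      simp [rescale, algHom_C]
      linear_combination C ν * X (.u 1) * e₇ + C ν * X (.u 0) ^ 2 * e₉ + C ν * X (.s 0 0) * e₁₀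
    | 1 =>
      simp [rescale, algHom_C]
      linear_combination C ν * X (.u 0) * e₈
    | 2 =>
      simp [rescale, algHom_C]
      linear_combination C ν * e₆
    | k + 3 => simp

/-- The parameter solves `(1+2a)/3 = b₁`. The choice `μ = 1/b₈` normalizes `u U_x`, and `ν² =
4/(3b₅b₈)` then normalizes `⟨U,U_x⟩`; the square root exists over `ℂ`. -/
theorem coincideUpToScaling_systemA {τ b₁ b₅ b₈ : ℂ} (hτ : τ ≠ 0) (h₅ : b₅ ≠ 0) (h₈ : b₈ ≠ 0) :
    (secondOrderSystem (τ * b₁) (τ * (2 * b₁ * b₈)) 0 0 (τ * b₅) τ (τ * ((1 - b₁) * b₈ / 2))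
      (τ * b₈) (τ * ((1 - 2 * b₁) * b₈ ^ 2 / 4)) (τ * (-b₅ * b₈ / 4))).CoincideUpToScaling
      (systemA ((3 * b₁ - 1) / 2)) := by
  obtain ⟨ν, hν⟩ := IsAlgClosed.exists_pow_nat_eq (4 / (3 * b₅ * b₈)) two_pos
  have hν₀ : ν ≠ 0 := by
    rintro rfl
    have : 4 / (3 * b₅ * b₈) ≠ 0 := by simp [h₅, h₈]
    simp_all
  refine coincideUpToScaling_of (μ := b₈⁻¹) hτ (inv_ne_zero h₈) hν₀ ?_ ?_ ?_ ?_ ?_ ?_ ?_ ?_ ?_ ?_ <;>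
    (try rw [hν]) <;> (try field_simp) <;> (try ring)

theorem coincideUpToScaling_systemB {τ b₅ b₇ : ℂ} (hτ : τ ≠ 0) (h₅ : b₅ ≠ 0) (h₇ : b₇ ≠ 0) :
    (secondOrderSystem τ (τ * (-4 * b₇)) 0 0 (τ * b₅) 0 (τ * b₇) 0 (τ * (-2 * b₇ ^ 2))
      (τ * (b₅ * b₇ / 2))).CoincideUpToScaling systemB := by
  obtain ⟨ν, hν⟩ := IsAlgClosed.exists_pow_nat_eq (-1 / (b₅ * b₇)) two_pos
  have hν₀ : ν ≠ 0 := by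
    rintro rfl
    have : -1 / (b₅ * b₇) ≠ 0 := by simp [h₅, h₇]
    simp_all
  refine coincideUpToScaling_of (μ := -1 / (2 * b₇)) hτ (by simp [h₇]) hν₀
    ?_ ?_ ?_ ?_ ?_ ?_ ?_ ?_ ?_ ?_ <;>
    (try rw [hν]) <;> (try field_simp) <;> (try ring)

theorem coincideUpToScaling_systemC {τ b₅ b₈ : ℂ} (hτ : τ ≠ 0) (h₅ : b₅ ≠ 0) (h₈ : b₈ ≠ 0) :
    (secondOrderSystem τ (τ * (2 * b₈)) 0 0 (τ * b₅) 0 (τ * (b₈ / 2)) (τ * b₈) 0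
      0).CoincideUpToScaling systemC := by
  obtain ⟨ν, hν⟩ := IsAlgClosed.exists_pow_nat_eq (1 / (b₅ * b₈)) two_pos
  have hν₀ : ν ≠ 0 := by
    rintro rfl
    have : 1 / (b₅ * b₈) ≠ 0 := by simp [h₅, h₈]
    simp_all
  refine coincideUpToScaling_of (μ := b₈⁻¹) hτ (inv_ne_zero h₈) hν₀ ?_ ?_ ?_ ?_ ?_ ?_ ?_ ?_ ?_ ?_ <;>
    (try rw [hν]) <;> (try field_simp) <;> (try ring)

end CoupledEvolution

end

/-! ### Case distinction on the leading coefficients -/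

open CoupledEvolution Reflection in
theorem mainTheorem8 (a₁ a₂ a₃ a₄ a₅ a₆ a₇ a₈ a₉ a₁₀ : ℂ)
    (h_order : a₁ ≠ 0 ∨ a₆ ≠ 0)
    (h_coupled_u : a₄ ≠ 0 ∨ a₅ ≠ 0)
    (h_coupled_U : a₇ ≠ 0 ∨ a₈ ≠ 0 ∨ a₉ ≠ 0)
    (h_symmetry : ∃ T : CoupledEvolution.EvolutionSystem,
      (CoupledEvolution.secondOrderSystem a₁ a₂ a₃ a₄ a₅ a₆ a₇ a₈ a₉ a₁₀).IsSymmetryOfOrder 4 T) :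
    (∃ a : ℂ,
      (CoupledEvolution.secondOrderSystem a₁ a₂ a₃ a₄ a₅ a₆ a₇ a₈ a₉ a₁₀).CoincideUpToScaling
        (CoupledEvolution.systemA a)) ∨
    (CoupledEvolution.secondOrderSystem a₁ a₂ a₃ a₄ a₅ a₆ a₇ a₈ a₉ a₁₀).CoincideUpToScaling
      CoupledEvolution.systemB ∨
    (CoupledEvolution.secondOrderSystem a₁ a₂ a₃ a₄ a₅ a₆ a₇ a₈ a₉ a₁₀).CoincideUpToScaling
      CoupledEvolution.systemC := by
  obtain ⟨T, hT, hfourth, -, -, hc⟩ := h_symmetry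
  have hE := determined_of_flowsCommute hT hc
  set γ := parameter [a₁, a₂, a₃, a₄, a₅, a₆, a₇, a₈, a₉, a₁₀] T with hγ
  have g₁ : γ 1 = a₁ := rfl
  have g₂ : γ 2 = a₂ := rfl
  have g₃ : γ 3 = a₃ := rfl
  have g₄ : γ 4 = a₄ := rfl
  have g₅ : γ 5 = a₅ := rfl
  have g₆ : γ 6 = a₆ := rfl
  have g₇ : γ 7 = a₇ := rfl
  have g₈ : γ 8 = a₈ := rfl
  have g₉ : γ 9 = a₉ := rfl
  have g₁₀ : γ 10 = a₁₀ := rfl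
  have hne : γ 47 ≠ 0 ∨ γ 65 ≠ 0 := by
    refine hfourth.imp (fun h => ?_) fun h => ?_
    · simpa [hγ, parameter, scalarTerms, exponent] using h
    · obtain ⟨d, hd⟩ := MvPolynomial.ne_zero_iff.1 h
      have hw := hT.2 4 d hd
      -- By homogeneity the coefficient of `U_xxxx` has weight `0`, so it is a constant.
      obtain ⟨l, hl, rfl⟩ := exists_terms 0 (by norm_num) d (by omega)
      obtain rfl : l = [] := by simpa [terms, vectorTerms] using hl
      simpa [hγ, parameter, vectorTerms] using hd
  clear_value γ
  have hdiv {α : ℂ} (hα : α ≠ 0) (i : ℕ) : γ i = α * (γ i / α) := (mul_div_cancel₀ _ hα).symm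
  have hzero {α : ℂ} (hα : α ≠ 0) (i : ℕ) : γ i / α ≠ 0 ↔ γ i ≠ 0 := by simp [hα]
  rw [← g₄, ← g₅] at h_coupled_u
  rw [← g₇, ← g₈, ← g₉] at h_coupled_U
  rw [← g₁, ← g₂, ← g₃, ← g₄, ← g₅, ← g₆, ← g₇, ← g₈, ← g₉, ← g₁₀]
  by_cases h₆ : a₆ = 0
  · have h₁ : a₁ ≠ 0 := by simpa [h₆] using h_order
    have hk : γ 65 = 0 := by
      -- Only the system is normalized here, since it is not yet known which leading coefficient of
      -- the symmetry is nonzero.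
      simpa using (hE.div a₁ 1).fourth_vanishes (by simpa only [hzero h₁])
        (by simpa only [hzero h₁]) (by simp [g₁, h₁]) (by simp [g₆, h₆])
    have hh : γ 47 ≠ 0 := by simpa [hk] using hne
    obtain ⟨c₃, c₄, c₅, ⟨c₈, c₂, c₇, c₉, c₁₀⟩ | ⟨c₇, c₈, c₂, c₉, c₁₀⟩⟩ :=
      (hE.div a₁ (γ 47)).scalar_order_two (by simpa only [hzero h₁])
        (by simpa only [hzero h₁]) (by simp [g₁, h₁]) (by simp [g₆, h₆]) (by simp [hh])
        (by simp [hk])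
    · refine .inr (.inr ?_)
      rw [g₁, g₆, h₆, hdiv h₁ 2, hdiv h₁ 3, hdiv h₁ 4, hdiv h₁ 5, hdiv h₁ 7, hdiv h₁ 8, hdiv h₁ 9,
        hdiv h₁ 10, c₂, c₃, c₄, c₇, c₉, c₁₀, mul_zero]
      exact coincideUpToScaling_systemC h₁ c₅ c₈
    · refine .inr (.inl ?_)
      rw [g₁, g₆, h₆, hdiv h₁ 2, hdiv h₁ 3, hdiv h₁ 4, hdiv h₁ 5, hdiv h₁ 7, hdiv h₁ 8, hdiv h₁ 9,
        hdiv h₁ 10, c₂, c₃, c₄, c₈, c₉, c₁₀, mul_zero]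
      exact coincideUpToScaling_systemB h₁ c₅ c₇
  · by_cases hk : γ 65 = 0
    · have hh : γ 47 ≠ 0 := by simpa [hk] using hne
      obtain ⟨c₄, c₅⟩ := (hE.div a₆ (γ 47)).decoupled (by simp [g₆, h₆]) (by simp [hh])
        (by simp [hk])
      exact absurd h_coupled_u (by simpa [h₆] using And.intro c₄ c₅)
    · obtain ⟨c₃, c₄, c₅, c₈, c₂, c₇, c₉, c₁₀⟩ :=
        (hE.div a₆ (γ 65)).vector_order_two (by simpa only [hzero h₆])
          (by simpa only [hzero h₆]) (by simp [g₆, h₆]) (by simp [hk])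
      rw [g₆, hdiv h₆ 1, hdiv h₆ 2, hdiv h₆ 3, hdiv h₆ 4, hdiv h₆ 5, hdiv h₆ 7, hdiv h₆ 8,
        hdiv h₆ 9, hdiv h₆ 10, c₂, c₃, c₄, c₇, c₉, c₁₀, mul_zero]
      exact .inl ⟨_, coincideUpToScaling_systemA h₆ c₅ c₈⟩
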